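/- Let $\mathcal H$ be a separable complex Hilbert space, $\mathfrak T(\mathcal H)$ its space of trace-class operators, $\mathfrak B(\mathcal H)$ its bounded operators, and let $\mathfrak M$ be an instrument on a measurable space $(X,\mathcal F)$, i.e. a $\sigma$-additive measure on $(X,\mathcal F)$ whose values are completely positive linear maps $\mathfrak M(F)$ of $\mathfrak T(\mathcal H)$ with $\mathfrak M(X)$ trace preserving; $\mathfrak M^*(F)$ is the dual map on $\mathfrak B(\mathcal H)$. For a state $\rho$ put $\mu_\rho(F)=\operatorname{Tr}\mathfrak M(F)[\rho]$; a family of posterior states for $\rho$ is a family $(\rho_x)_{x\in X}$, a state for $\mu_\rho$-almost all $x$, with $x\mapsto\operatorname{Tr}A\rho_x$ measurable for all $A\in\mathfrak B(\mathcal H)$ and $\int_F\rho_x\,\mu_\rho(dx)=\mathfrak M(F)[\rho]$ for all $F\in\mathcal F$. The instrument is *irreducible* if for every pure $\rho$ the posterior states $\rho_x$ are pure for $\mu_\rho$-almost all $x$. It is *efficient* if there are a Hilbert space $\mathcal H_0$, an isometry $V:\mathcal H\to\mathcal H\otimes\mathcal H_0$ and a spectral measure $P$ on $X$ in $\mathcal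 H_0$ of multiplicity one (i.e. with a cyclic vector) such that $\mathfrak M^*(F)[A]=V^*(A\otimes P(F))V$ for all $F\in\mathcal F$, $A\in\mathfrak B(\mathcal H)$. Let $\mu$ be a $\sigma$-finite measure on $(X,\mathcal F)$, $\mathcal D\subseteq\mathcal H$ a dense subspace that is the linear span of a countable set (for instance of an orthonormal basis), and $V_k(x):\mathcal D\to\mathcal H$ ($k=1,2,\dots$, $x\in X$) linear, possibly unbounded operators with $x\mapsto V_k(x)\varphi$ $\mu$-measurable, $\int_X\sum_k\|V_k(x)\varphi\|^2\mu(dx)<\infty$ and $$\langle\varphi|\mathfrak M^*(F)[A]\varphi\rangle=\int_F\sum_k\langle V_k(x)\varphi|A V_k(x)\varphi\rangle\,\mu(dx)\qquad(\varphi\in\mathcal D,\ F\in\mathcal F,\ A\in\mathfrak B(\mathcal H)).$$ Assume the normalization that for $\mu$-almost all $x$ no two nonzero operators $V_j(x),V_k(x)$ with $j\ne k$ are proportional, and $V_j(x)=0$ implies $V_k(x)=0$ for all $k>j$. Let $F_s=\{x\in X: V_2(x)\neq0\}$. **Proposition.** Suppose $\mathfrak M$ is irreducible but not efficient. Then $\mathfrak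 M(F)\ne0$ for some measurable $F\subseteq F_s$, and there are a measurable family $(\psi_x)_{x\in X}$ of unit vectors of $\mathcal H$ and linear functionals $\omega_k(x)$ on $\mathcal D$ (not necessarily bounded) such that: 1. for $\mu$-almost all $x\in F_s$ every nonzero $V_k(x)$ has range $\mathbb C\psi_x$, and $V_k(x)\varphi=\omega_k(x)[\varphi]\,\psi_x$ for all $k$ and all $\varphi\in\mathcal D$; 2. for all $\varphi\in\mathcal D$, $A\in\mathfrak B(\mathcal H)$ and measurable $F\subseteq F_s$, $$\langle\varphi|\mathfrak M^*(F)[A]\varphi\rangle=\int_F\langle\psi_x|A\psi_x\rangle\sum_k|\omega_k(x)[\varphi]|^2\,\mu(dx);$$ 3. for every state $\rho$ the posterior state on $F_s$ is $|\psi_x\rangle\langle\psi_x|$, independently of $\rho$: one has $\mathfrak M(F)[\rho]=\int_F|\psi_x\rangle\langle\psi_x|\,\mu_\rho(dx)$ for all measurable $F\subseteq F_s$, and every family $(\rho_x)$ of posterior states for $\rho$ satisfies $\rho_x=|\psi_x\rangle\langle\psi_x|$ for $\mu_\rho$-almost all $x\in F_s$. -/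

import Mathlib

open MeasureTheory Filter
open scoped InnerProductSpace ENNReal ComplexOrder TensorProduct

namespace QuantumInstrument

universe u v

section TraceClass

theorem exists_nuclear_add {H : Type u} [NormedAddCommGroup H] [InnerProductSpace ℂ H]
    (e : ℕ ≃ ℕ ⊕ ℕ) {S T : H → H} {a b c d : ℕ → H} (hab : Summable (fun n => ‖a n‖ * ‖b n‖))
    (hS : ∀ x, HasSum (fun n => ⟪b n, x⟫_ℂ • a n) (S x))
    (hcd : Summable (fun n => ‖c n‖ * ‖d n‖))
    (hT : ∀ x, HasSum (fun n => ⟪d n, x⟫_ℂ • c n) (T x)) :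
    ∃ a b : ℕ → H, Summable (fun n => ‖a n‖ * ‖b n‖) ∧
      ∀ x, HasSum (fun n => ⟪b n, x⟫_ℂ • a n) (S x + T x) := by
  refine ⟨fun n => Sum.elim a c (e n), fun n => Sum.elim b d (e n), ?_, fun x => ?_⟩
  · have h : Summable (fun s : ℕ ⊕ ℕ => ‖Sum.elim a c s‖ * ‖Sum.elim b d s‖) :=
      Summable.sum (f := fun s : ℕ ⊕ ℕ => ‖Sum.elim a c s‖ * ‖Sum.elim b d s‖) hab hcd
    exact e.summable_iff.mpr h
  · have h : HasSum (fun s : ℕ ⊕ ℕ => ⟪Sum.elim b d s, x⟫_ℂ • Sum.elim a c s) (S x + T x) :=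
      HasSum.sum (f := fun s : ℕ ⊕ ℕ => ⟪Sum.elim b d s, x⟫_ℂ • Sum.elim a c s) (hS x) (hT x)
    exact e.hasSum_iff.mpr h

/-- The trace-class operators `𝔗(H)` on a Hilbert space, in the nuclear description: the operators
`T = ∑ₙ |aₙ⟩⟨bₙ|` with `∑ₙ ‖aₙ‖ ‖bₙ‖ < ∞`. -/
def traceClass (H : Type u) [NormedAddCommGroup H] [InnerProductSpace ℂ H] :
    Submodule ℂ (H →L[ℂ] H) where
  carrier := {T | ∃ a b : ℕ → H, Summable (fun n => ‖a n‖ * ‖b n‖) ∧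
    ∀ x, HasSum (fun n => ⟪b n, x⟫_ℂ • a n) (T x)}
  zero_mem' := ⟨0, 0, by simp [summable_zero], fun x => by simp [hasSum_zero]⟩
  add_mem' := by
    rintro S T ⟨a, b, hab, hS⟩ ⟨c, d, hcd, hT⟩
    exact exists_nuclear_add Equiv.natSumNatEquivNat.symm hab hS hcd hT
  smul_mem' := by
    rintro z T ⟨a, b, hab, hT⟩
    refine ⟨fun n => z • a n, b, ?_, fun x => ?_⟩
    · simpa [norm_smul, mul_assoc] using hab.mul_left ‖z‖
    · have h := (hT x).const_smul z
      simp only [smul_comm z] at h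
      exact h

/-- `|φ⟩⟨χ|` as a trace-class operator. -/
noncomputable def ketBra {H : Type u} [NormedAddCommGroup H] [InnerProductSpace ℂ H] (φ χ : H) :
    traceClass H :=
  ⟨InnerProductSpace.rankOne ℂ φ χ, fun n => if n = 0 then φ else 0, fun _ => χ,
    summable_of_ne_finset_zero (s := {0}) (fun n hn => by
      have : n ≠ 0 := by simpa using hn
      simp [this]),
    fun x => by
      have h := hasSum_single (f := fun n : ℕ => ⟪χ, x⟫_ℂ • (if n = 0 then φ else 0)) 0
        (fun n hn => by simp [hn])
      simpa using h⟩

/-- The trace `∑ᵢ ⟨eᵢ, T eᵢ⟩` along an orthonormal basis `(eᵢ)`; for trace-class `T` the series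
converges absolutely and does not depend on the basis. -/
noncomputable def trace {H : Type u} [NormedAddCommGroup H] [InnerProductSpace ℂ H]
    [CompleteSpace H] (T : H →L[ℂ] H) : ℂ :=
  ∑' i, ⟪(exists_hilbertBasis ℂ H).choose_spec.choose i,
    T ((exists_hilbertBasis ℂ H).choose_spec.choose i)⟫_ℂ

theorem trace_nonneg {H : Type u} [NormedAddCommGroup H] [InnerProductSpace ℂ H]
    [CompleteSpace H] {T : H →L[ℂ] H} (hT : ∀ v, 0 ≤ ⟪v, T v⟫_ℂ) : 0 ≤ trace T :=
  tsum_nonneg fun _ => hT _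

/-- Density operators: positive trace-class operators of trace one. -/
structure IsState {H : Type u} [NormedAddCommGroup H] [InnerProductSpace ℂ H] [CompleteSpace H]
    (ρ : traceClass H) : Prop where
  nonneg : ∀ v : H, 0 ≤ ⟪v, (ρ : H →L[ℂ] H) v⟫_ℂ
  trace_eq_one : trace (ρ : H →L[ℂ] H) = 1

/-- Pure states: the one-dimensional projections `|φ⟩⟨φ|`, `‖φ‖ = 1`. -/
def IsPure {H : Type u} [NormedAddCommGroup H] [InnerProductSpace ℂ H]
    (ρ : traceClass H) : Prop :=
  ∃ φ : H, ‖φ‖ = 1 ∧ ρ = ketBra φ φ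

/-- Complete positivity of a linear map `Φ` of `𝔗(H)`: for every `n` the map `Φ ⊗ Id` preserves
positivity of `n × n` operator matrices with entries in `𝔗(H)`. -/
def IsCompletelyPositive {H : Type u} [NormedAddCommGroup H] [InnerProductSpace ℂ H]
    (Φ : traceClass H →ₗ[ℂ] traceClass H) : Prop :=
  ∀ (n : ℕ) (T : Fin n → Fin n → traceClass H),
    (∀ v : Fin n → H, 0 ≤ ∑ i, ∑ j, ⟪v i, (T i j : H →L[ℂ] H) (v j)⟫_ℂ) →
    ∀ v : Fin n → H, 0 ≤ ∑ i, ∑ j, ⟪v i, (Φ (T i j) : H →L[ℂ] H) (v j)⟫_ℂ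

end TraceClass

/-- An instrument in the space of states: a σ-additive measure on `X` whose values are completely
positive maps of `𝔗(H)`, with `𝔐(X)` trace preserving (so every `𝔐(F)` is trace non-increasing).
Only the values at measurable sets are relevant. σ-additivity is required in the weak topology
given by the duality `(T, A) ↦ Tr (A T)` between `𝔗(H)` and `𝔅(H)`; by positivity this is the same
as convergence in trace norm. -/
structure Instrument (X : Type v) [MeasurableSpace X] (H : Type u) [NormedAddCommGroup H]
    [InnerProductSpace ℂ H] [CompleteSpace H] where
  op : Set X → traceClass H →ₗ[ℂ] traceClass H
  completelyPositive : ∀ F, MeasurableSet F → IsCompletelyPositive (op F)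
  sigmaAdditive : ∀ F : ℕ → Set X, (∀ i, MeasurableSet (F i)) →
    Pairwise (Function.onFun Disjoint F) → ∀ (T : traceClass H) (A : H →L[ℂ] H),
    HasSum (fun i => trace (A ∘L (op (F i) T : H →L[ℂ] H)))
      (trace (A ∘L (op (⋃ i, F i) T : H →L[ℂ] H)))
  tracePreserving : ∀ T : traceClass H,
    trace (op Set.univ T : H →L[ℂ] H) = trace (T : H →L[ℂ] H)

section Posterior

variable {X : Type v} [MeasurableSpace X] {H : Type u} [NormedAddCommGroup H]
  [InnerProductSpace ℂ H] [CompleteSpace H]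

theorem Instrument.trace_op_nonneg (M : Instrument X H) {ρ : traceClass H} (hρ : IsState ρ)
    {F : Set X} (hF : MeasurableSet F) : 0 ≤ trace (M.op F ρ : H →L[ℂ] H) := by
  refine trace_nonneg fun w => ?_
  have h := M.completelyPositive F hF 1 (fun _ _ => ρ) (fun v => by simpa using hρ.nonneg (v 0))
    (fun _ => w)
  simpa using h

theorem Instrument.hasSum_trace_op (M : Instrument X H) (ρ : traceClass H) {F : ℕ → Set X}
    (hF : ∀ i, MeasurableSet (F i)) (hd : Pairwise (Function.onFun Disjoint F)) :
    HasSum (fun i => trace (M.op (F i) ρ : H →L[ℂ] H)) (trace (M.op (⋃ i, F i) ρ : H →L[ℂ] H)) := by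
  simpa only [ContinuousLinearMap.id_comp] using
    M.sigmaAdditive F hF hd ρ (ContinuousLinearMap.id ℂ H)

/-- The outcome distribution `μ_ρ(F) = Tr 𝔐(F)[ρ]` in the a priori state `ρ`. -/
noncomputable def Instrument.outcomeMeasure (M : Instrument X H) (ρ : traceClass H)
    (hρ : IsState ρ) : Measure X :=
  Measure.ofMeasurable (fun F _ => ENNReal.ofReal (trace (M.op F ρ : H →L[ℂ] H)).re)
    (by
      have h := M.hasSum_trace_op ρ (F := fun _ => (∅ : Set X)) (fun _ => MeasurableSet.empty)
        (fun _ _ _ => by simp [Function.onFun])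
      have h0 : trace (M.op (∅ : Set X) ρ : H →L[ℂ] H) = 0 :=
        tendsto_nhds_unique tendsto_const_nhds h.summable.tendsto_atTop_zero
      simp [h0])
    (by
      intro F hF hd
      have h := Complex.hasSum_re (M.hasSum_trace_op ρ hF hd)
      have hn : ∀ i, 0 ≤ (trace (M.op (F i) ρ : H →L[ℂ] H)).re := fun i =>
        (Complex.nonneg_iff.mp (M.trace_op_nonneg hρ (hF i))).1
      rw [← ENNReal.ofReal_tsum_of_nonneg hn h.summable, h.tsum_eq])

/-- `x ↦ r x` is a family of posterior states for the a priori state `ρ`: `r x` is a state for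
`μ_ρ`-almost all `x`, `x ↦ Tr (A (r x))` is measurable for all bounded `A`, and
`∫_F r x μ_ρ(dx) = 𝔐(F)[ρ]` for all measurable `F`. As the `r x` have trace norm one and `𝔅(H)` is
the dual of `𝔗(H)`, the `𝔗(H)`-valued integral is determined by pairing with all bounded `A`. -/
structure Instrument.IsPosteriorFamily (M : Instrument X H) (ρ : traceClass H)
    (hρ : IsState ρ) (r : X → traceClass H) : Prop where
  isState : ∀ᵐ x ∂(M.outcomeMeasure ρ hρ), IsState (r x)
  aemeasurable : ∀ A : H →L[ℂ] H,
    AEMeasurable (fun x => trace (A ∘L (r x : H →L[ℂ] H))) (M.outcomeMeasure ρ hρ)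
  integral_eq : ∀ (F : Set X), MeasurableSet F → ∀ A : H →L[ℂ] H,
    ∫ x in F, trace (A ∘L (r x : H →L[ℂ] H)) ∂(M.outcomeMeasure ρ hρ) =
      trace (A ∘L (M.op F ρ : H →L[ℂ] H))

/-- An instrument is irreducible if for every pure a priori state the posterior states are pure for
`μ_ρ`-almost all outcomes. -/
def Instrument.IsIrreducible (M : Instrument X H) : Prop :=
  ∀ (ρ : traceClass H) (hρ : IsState ρ), IsPure ρ →
    ∀ r : X → traceClass H, M.IsPosteriorFamily ρ hρ r →
      ∀ᵐ x ∂(M.outcomeMeasure ρ hρ), IsPure (r x)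

end Posterior

section Efficient

/-- A spectral (projection-valued) measure on `X` in the Hilbert space `K`. -/
structure SpectralMeasure (X : Type v) [MeasurableSpace X] (K : Type u) [NormedAddCommGroup K]
    [InnerProductSpace ℂ K] [CompleteSpace K] where
  proj : Set X → K →L[ℂ] K
  isStarProjection : ∀ F, MeasurableSet F → IsStarProjection (proj F)
  univ_eq : proj Set.univ = ContinuousLinearMap.id ℂ K
  sigmaAdditive : ∀ F : ℕ → Set X, (∀ i, MeasurableSet (F i)) →
    Pairwise (Function.onFun Disjoint F) → ∀ v : K,
    HasSum (fun i => proj (F i) v) (proj (⋃ i, F i) v)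

/-- Multiplicity one (simple spectrum): there is a cyclic vector. -/
def SpectralMeasure.HasMultiplicityOne {X : Type v} [MeasurableSpace X] {K : Type u}
    [NormedAddCommGroup K] [InnerProductSpace ℂ K] [CompleteSpace K]
    (P : SpectralMeasure X K) : Prop :=
  ∃ c : K, (Submodule.span ℂ {w | ∃ F, MeasurableSet F ∧ w = P.proj F c}).topologicalClosure = ⊤

/-- The Hilbert space tensor product. -/
abbrev HilbertTensor (H : Type u) (K : Type v) [NormedAddCommGroup H] [InnerProductSpace ℂ H]
    [NormedAddCommGroup K] [InnerProductSpace ℂ K] : Type (max u v) :=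
  UniformSpace.Completion (H ⊗[ℂ] K)

/-- The operator `A ⊗ B` on the Hilbert space tensor product. -/
noncomputable def tensorOp {H : Type u} {K : Type v} [NormedAddCommGroup H]
    [InnerProductSpace ℂ H] [NormedAddCommGroup K] [InnerProductSpace ℂ K]
    (A : H →L[ℂ] H) (B : K →L[ℂ] K) : HilbertTensor H K →L[ℂ] HilbertTensor H K :=
  (TensorProduct.mapL A B).completion

/-- An instrument is efficient if `𝔐*(F)[A] = V* (A ⊗ P(F)) V` for some isometry `V : H → H ⊗ K` and
some spectral measure `P` in `K` of multiplicity one. The dual map `𝔐*(F)` is characterized by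
`Tr (A 𝔐(F)[T]) = Tr (𝔐*(F)[A] T)`. (A space with a spectral measure of multiplicity one on `X` is
an `L²` space over `X`, so it is no restriction that `K` lives in the universe of `X`.) -/
def Instrument.IsEfficient {X : Type v} [MeasurableSpace X] {H : Type u} [NormedAddCommGroup H]
    [InnerProductSpace ℂ H] [CompleteSpace H] (M : Instrument X H) : Prop :=
  ∃ (K : Type v) (_ : NormedAddCommGroup K) (_ : InnerProductSpace ℂ K) (_ : CompleteSpace K)
    (P : SpectralMeasure X K) (V : H →ₗᵢ[ℂ] HilbertTensor H K), P.HasMultiplicityOne ∧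
    ∀ F, MeasurableSet F → ∀ (A : H →L[ℂ] H) (T : traceClass H),
      trace (A ∘L (M.op F T : H →L[ℂ] H)) =
        trace ((ContinuousLinearMap.adjoint V.toContinuousLinearMap ∘L tensorOp A (P.proj F) ∘L
          V.toContinuousLinearMap) ∘L (T : H →L[ℂ] H))

end Efficient

/-- A (countable) Kraus-type Radon–Nikodym representation of the instrument `M`: linear, possibly
unbounded, operators `V k x` on a dense domain `D` of countable algebraic dimension with
`⟨φ, 𝔐*(F)[A] φ⟩ = ∫_F ∑ₖ ⟨Vₖ(x) φ, A Vₖ(x) φ⟩ μ(dx)`, where the left-hand side is by definition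
`Tr (A 𝔐(F)[|φ⟩⟨φ|])`. The family is indexed from `0` and, if finite, continued by zero operators.
It is normalized: for almost every `x` the nonzero `V k x` are pairwise non-proportional and precede
the zero ones. -/
structure KrausRepresentation {X : Type v} [MeasurableSpace X] {H : Type u} [NormedAddCommGroup H]
    [InnerProductSpace ℂ H] [CompleteSpace H] (M : Instrument X H) (μ : Measure X)
    (D : Submodule ℂ H) (V : ℕ → X → D →ₗ[ℂ] H) : Prop where
  dense : Dense (D : Set H)
  countable_span : ∃ s : Set H, s.Countable ∧ Submodule.span ℂ s = D
  aestronglyMeasurable : ∀ (k : ℕ) (φ : D), AEStronglyMeasurable (fun x => V k x φ) μ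
  lintegral_lt_top : ∀ φ : D, ∫⁻ x, ∑' k, ‖V k x φ‖ₑ ^ 2 ∂μ < ∞
  trace_eq : ∀ (φ : D) (F : Set X), MeasurableSet F → ∀ A : H →L[ℂ] H,
    trace (A ∘L (M.op F (ketBra (φ : H) φ) : H →L[ℂ] H)) =
      ∫ x in F, ∑' k, ⟪V k x φ, A (V k x φ)⟫_ℂ ∂μ
  not_proportional : ∀ᵐ x ∂μ, ∀ j k, j ≠ k → V j x ≠ 0 → V k x ≠ 0 → ∀ c : ℂ, V k x ≠ c • V j x
  zero_of_le : ∀ᵐ x ∂μ, ∀ j k, j ≤ k → V j x = 0 → V k x = 0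

end QuantumInstrument

/-! The operators are numbered from `0`, so $F_s$ is the set where `V 1 x ≠ 0`.

For a unit vector $\varphi\in\mathcal D$ a posterior family is $\sum_k|V_k(x)\varphi\rangle\langle
V_k(x)\varphi|$ divided by its trace. Irreducibility makes it pure, which forces all the vectors
$V_k(x)\varphi$ onto one line for almost every $x$ (`ae_exists_smul`). The exceptional null set
depends on $\varphi$. However, "$V_0(x)\varphi$ and $V_k(x)\varphi$ are parallel" is a family of
quadratic equations in $\varphi$, so by polarization it is enough to test a countable spanning
sequence and its pairwise sums (`exists_smul_of_span`). Thus, for almost every $x$, $V_k(x)\varphi$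
is a multiple of $V_0(x)\varphi$ wherever the latter is nonzero. Two such operators that are not
globally proportional have their ranges in a common line (`exists_smul_of_locally_dependent`); on
$F_s$ this line is $\mathbb C\psi_x$.

States outside $\mathcal D$ are reached by a density principle (`eq_zero_of_bounded_of_dense`): a
linear functional on the trace class that is bounded on states is determined by the pure states with
vectors in $\mathcal D$. Posterior states are then identified by uniqueness of densities, tested on
countably many rank-one operators.

If $V_1=0$ almost everywhere, $\varphi\mapsto V_0(\cdot)\varphi$ extends to an isometry into
$L^2(\mu;\mathcal H)$, which embeds in $\mathcal H\otimes L^2(\mu)$. With multiplication by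
indicators as spectral measure the instrument is efficient (`isEfficient_of_ae_eq_zero`). Hence
inefficiency makes $\mathfrak M$ nonzero on a part of $F_s$. -/

namespace QuantumInstrument

universe u v

/-! ### Traces of nuclear operators and of positive operators -/

section TraceTheory

variable {H : Type*} [NormedAddCommGroup H] [InnerProductSpace ℂ H]

theorem hasSum_sq_norm_inner {ι : Type*} (e : HilbertBasis ι ℂ H) (x : H) :
    HasSum (fun i => ‖⟪e i, x⟫_ℂ‖ ^ 2) (‖x‖ ^ 2) := by
  have h := Complex.hasSum_re (e.hasSum_inner_mul_inner x x)
  convert h using 1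
  · funext i
    rw [← inner_conj_symm x (e i), ← Complex.normSq_eq_conj_mul_self, Complex.ofReal_re,
      Complex.normSq_eq_norm_sq]
  · exact (inner_self_eq_norm_sq (𝕜 := ℂ) x).symm

theorem summable_norm_inner_mul_norm_inner {ι : Type*} (e : HilbertBasis ι ℂ H) (x y : H) :
    Summable (fun i => ‖⟪e i, x⟫_ℂ‖ * ‖⟪y, e i⟫_ℂ‖) ∧
      ∑' i, ‖⟪e i, x⟫_ℂ‖ * ‖⟪y, e i⟫_ℂ‖ ≤ ‖x‖ * ‖y‖ := by
  have hx := hasSum_sq_norm_inner e x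
  have hy := hasSum_sq_norm_inner e y
  have key : ∀ s : Finset ι, ∑ i ∈ s, ‖⟪e i, x⟫_ℂ‖ * ‖⟪y, e i⟫_ℂ‖ ≤ ‖x‖ * ‖y‖ := by
    intro s
    refine abs_le_of_sq_le_sq' ?_ (by positivity) |>.2
    refine (Finset.sum_mul_sq_le_sq_mul_sq _ _ _).trans ?_
    rw [mul_pow]
    refine mul_le_mul (sum_le_hasSum s (fun _ _ => by positivity) hx) ?_
      (Finset.sum_nonneg fun _ _ => by positivity) (by positivity)
    simp only [norm_inner_symm y]
    exact sum_le_hasSum s (fun _ _ => by positivity) hy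
  have hs := summable_of_sum_le (fun i => by positivity) key
  exact ⟨hs, hs.tsum_le_of_sum_le key⟩

/-- Basis independence of the trace: the double series $\langle b_n,e_i\rangle\langle
e_i,a_n\rangle$ converges absolutely by Cauchy–Schwarz and Parseval, so it may be summed in either
order. -/
theorem hasSum_inner_of_nuclear {ι κ : Type*} (e : HilbertBasis ι ℂ H) {T : H → H} {a b : κ → H}
    (hab : Summable (fun n => ‖a n‖ * ‖b n‖))
    (hT : ∀ x, HasSum (fun n => ⟪b n, x⟫_ℂ • a n) (T x)) :
    HasSum (fun i => ⟪e i, T (e i)⟫_ℂ) (∑' n, ⟪b n, a n⟫_ℂ) := by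
  set f : κ × ι → ℂ := fun p => ⟪b p.1, e p.2⟫_ℂ * ⟪e p.2, a p.1⟫_ℂ with hf
  have hn : ∀ p, ‖f p‖ = ‖⟪e p.2, a p.1⟫_ℂ‖ * ‖⟪b p.1, e p.2⟫_ℂ‖ := fun p => by
    rw [hf, norm_mul, mul_comm]
  have hs : Summable f := by
    refine Summable.of_norm ?_
    rw [summable_prod_of_nonneg fun _ => norm_nonneg _]
    simp only [hn]
    refine ⟨fun n => (summable_norm_inner_mul_norm_inner e (a n) (b n)).1, ?_⟩
    exact hab.of_nonneg_of_le (fun n => tsum_nonneg fun _ => by positivity)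
      fun n => (summable_norm_inner_mul_norm_inner e (a n) (b n)).2
  have h1 : HasSum (fun n => ⟪b n, a n⟫_ℂ) (∑' p, f p) :=
    hs.hasSum.prod_fiberwise fun n => e.hasSum_inner_mul_inner (b n) (a n)
  have h2 : HasSum (f ∘ Equiv.prodComm ι κ) (∑' p, f p) :=
    (Equiv.prodComm ι κ).hasSum_iff.mpr hs.hasSum
  rw [h1.tsum_eq]
  refine h2.prod_fiberwise fun i => ?_
  have := (hT (e i)).mapL (innerSL ℂ (e i))
  simpa [hf, inner_smul_right] using this

variable [CompleteSpace H]

theorem hasSum_trace_of_nuclear {κ : Type*} {T : H →L[ℂ] H} {a b : κ → H}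
    (hab : Summable (fun n => ‖a n‖ * ‖b n‖))
    (hT : ∀ x, HasSum (fun n => ⟪b n, x⟫_ℂ • a n) (T x)) :
    HasSum (fun n => ⟪b n, a n⟫_ℂ) (trace T) := by
  have h : Summable (fun n => ⟪b n, a n⟫_ℂ) := by
    refine Summable.of_norm_bounded hab fun n => ?_
    rw [mul_comm]; exact norm_inner_le_norm _ _
  rw [show trace T = ∑' n, ⟪b n, a n⟫_ℂ from (hasSum_inner_of_nuclear _ hab hT).tsum_eq]
  exact h.hasSum

omit [CompleteSpace H] in
theorem nuclear_comp {κ : Type*} {T : H →L[ℂ] H} {a b : κ → H} (A : H →L[ℂ] H)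
    (hab : Summable (fun n => ‖a n‖ * ‖b n‖))
    (hT : ∀ x, HasSum (fun n => ⟪b n, x⟫_ℂ • a n) (T x)) :
    Summable (fun n => ‖A (a n)‖ * ‖b n‖) ∧
      ∀ x, HasSum (fun n => ⟪b n, x⟫_ℂ • A (a n)) ((A ∘L T) x) := by
  refine ⟨(hab.mul_left ‖A‖).of_nonneg_of_le (fun _ => by positivity) fun n => ?_, fun x => ?_⟩
  · rw [← mul_assoc]; gcongr; exact A.le_opNorm _
  · simpa using (hT x).mapL A

theorem hasSum_trace_comp_of_nuclear {κ : Type*} {T : H →L[ℂ] H} {a b : κ → H} (A : H →L[ℂ] H)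
    (hab : Summable (fun n => ‖a n‖ * ‖b n‖))
    (hT : ∀ x, HasSum (fun n => ⟪b n, x⟫_ℂ • a n) (T x)) :
    HasSum (fun n => ⟪b n, A (a n)⟫_ℂ) (trace (A ∘L T)) :=
  hasSum_trace_of_nuclear (nuclear_comp A hab hT).1 (nuclear_comp A hab hT).2

omit [CompleteSpace H] in
theorem comp_mem_traceClass (A : H →L[ℂ] H) (T : traceClass H) :
    A ∘L (T : H →L[ℂ] H) ∈ traceClass H := by
  obtain ⟨a, b, hab, hT⟩ := T.2
  exact ⟨fun n => A (a n), b, nuclear_comp A hab hT⟩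

theorem summable_trace (T : traceClass H) :
    Summable fun i => ⟪(exists_hilbertBasis ℂ H).choose_spec.choose i,
      (T : H →L[ℂ] H) ((exists_hilbertBasis ℂ H).choose_spec.choose i)⟫_ℂ := by
  obtain ⟨a, b, hab, hT⟩ := T.2
  exact (hasSum_inner_of_nuclear _ hab hT).summable

/-- The functional `T ↦ Tr (A T)` on the trace class. -/
noncomputable def traceMul (A : H →L[ℂ] H) : traceClass H →ₗ[ℂ] ℂ where
  toFun T := trace (A ∘L (T : H →L[ℂ] H))
  map_add' S T := by
    have hS := summable_trace ⟨_, comp_mem_traceClass A S⟩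
    have hT := summable_trace ⟨_, comp_mem_traceClass A T⟩
    simp only [trace, ← hS.tsum_add hT, Submodule.coe_add, ContinuousLinearMap.comp_add,
      add_apply, inner_add_right]
  map_smul' z T := by
    simp only [trace, ← tsum_mul_left, Submodule.coe_smul, ContinuousLinearMap.comp_smul,
      smul_apply, inner_smul_right, RingHom.id_apply, smul_eq_mul]

theorem traceMul_apply (A : H →L[ℂ] H) (T : traceClass H) :
    traceMul A T = trace (A ∘L (T : H →L[ℂ] H)) := rfl

theorem trace_eq_traceMul_id (T : traceClass H) :
    trace (T : H →L[ℂ] H) = traceMul (ContinuousLinearMap.id ℂ H) T := by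
  rw [traceMul_apply, ContinuousLinearMap.id_comp]

omit [CompleteSpace H] in
theorem ketBra_apply (φ χ x : H) : (ketBra φ χ : H →L[ℂ] H) x = ⟪χ, x⟫_ℂ • φ := rfl

theorem traceMul_ketBra (A : H →L[ℂ] H) (φ χ : H) : traceMul A (ketBra φ χ) = ⟪χ, A φ⟫_ℂ := by
  rw [traceMul_apply]
  have h := hasSum_trace_comp_of_nuclear (κ := Unit) (T := (ketBra φ χ : H →L[ℂ] H))
    (a := fun _ => φ) (b := fun _ => χ) A (hasSum_fintype _).summable
    fun x => by simp [ketBra_apply]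
  simpa using h.unique (hasSum_fintype _)

theorem traceMul_rankOne (φ χ : H) (T : traceClass H) :
    traceMul (InnerProductSpace.rankOne ℂ φ χ) T = ⟪χ, (T : H →L[ℂ] H) φ⟫_ℂ := by
  rw [traceMul_apply]
  have h := hasSum_trace_of_nuclear (κ := Unit)
    (T := InnerProductSpace.rankOne ℂ φ χ ∘L (T : H →L[ℂ] H))
    (a := fun _ => φ) (b := fun _ => ContinuousLinearMap.adjoint (T : H →L[ℂ] H) χ)
    (hasSum_fintype _).summable fun x => by
      simp [ContinuousLinearMap.adjoint_inner_left]
  simpa [ContinuousLinearMap.adjoint_inner_left] using h.unique (hasSum_fintype _)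

/-- Positivity of a trace-class operator. -/
def IsPos (T : traceClass H) : Prop := ∀ v : H, 0 ≤ ⟪v, (T : H →L[ℂ] H) v⟫_ℂ

/-- With $S=\sqrt T$, take $c_i=Se_i$ for the basis that defines the trace:
$T=S\,1\,S=\sum|Se_i\rangle\langle Se_i|$ and $\langle e_i,Te_i\rangle=\|Se_i\|^2$. No eigenvector
decomposition is needed. -/
theorem IsPos.exists_hasSum {T : traceClass H} (hT : IsPos T) :
    ∃ (ι : Set H) (c : ι → H), HasSum (fun i => ‖c i‖ ^ 2) (trace (T : H →L[ℂ] H)).re ∧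
      ∀ x, HasSum (fun i => ⟪c i, x⟫_ℂ • c i) ((T : H →L[ℂ] H) x) := by
  obtain ⟨ι, e, he⟩ : ∃ (ι : Set H) (e : HilbertBasis ι ℂ H),
      HasSum (fun i => ⟪e i, (T : H →L[ℂ] H) (e i)⟫_ℂ) (trace (T : H →L[ℂ] H)) :=
    ⟨_, _, (summable_trace T).hasSum⟩
  have hpos : 0 ≤ (T : H →L[ℂ] H) := by
    rw [ContinuousLinearMap.nonneg_iff_isPositive, ContinuousLinearMap.isPositive_iff_complex]
    intro x
    have := Complex.nonneg_iff.mp (hT x)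
    rw [← inner_conj_symm]
    refine ⟨Complex.ext ?_ ?_, ?_⟩
    · simp
    · rw [Complex.conj_im, ← this.2]; simp
    · rw [RCLike.conj_re]; exact this.1
  set S := CFC.sqrt (T : H →L[ℂ] H) with hS
  have hSS : ∀ x, S (S x) = (T : H →L[ℂ] H) x := fun x => by
    conv_rhs => rw [← CFC.sqrt_mul_sqrt_self (T : H →L[ℂ] H) hpos]
    rfl
  have hsymm : ∀ x y, ⟪S x, y⟫_ℂ = ⟪x, S y⟫_ℂ := by
    have h := (ContinuousLinearMap.nonneg_iff_isPositive S).mp (CFC.sqrt_nonneg _)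
    exact fun x y => h.isSymmetric x y
  refine ⟨ι, fun i => S (e i), ?_, fun x => ?_⟩
  · have h := Complex.hasSum_re he
    convert h using 2 with i
    rw [← hSS, ← hsymm]
    exact (inner_self_eq_norm_sq (𝕜 := ℂ) _).symm
  · have h := (e.hasSum_repr (S x)).mapL S
    simpa [HilbertBasis.repr_apply_apply, hsymm, hSS] using h

theorem IsPos.hasSum_traceMul {T : traceClass H} {ι : Type*} {c : ι → H} {t : ℝ}
    (hc : HasSum (fun i => ‖c i‖ ^ 2) t)
    (hx : ∀ x, HasSum (fun i => ⟪c i, x⟫_ℂ • c i) ((T : H →L[ℂ] H) x)) (A : H →L[ℂ] H) :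
    HasSum (fun i => ⟪c i, A (c i)⟫_ℂ) (traceMul A T) :=
  hasSum_trace_comp_of_nuclear A (by simpa only [← sq] using hc.summable) hx

theorem IsPos.norm_traceMul_le {T : traceClass H} (hT : IsPos T) (A : H →L[ℂ] H) :
    ‖traceMul A T‖ ≤ ‖A‖ * (trace (T : H →L[ℂ] H)).re := by
  obtain ⟨ι, c, hc, hx⟩ := hT.exists_hasSum
  have h := IsPos.hasSum_traceMul hc hx A
  rw [← h.tsum_eq]
  refine tsum_of_norm_bounded (hc.mul_left ‖A‖) fun i => ?_
  calc ‖⟪c i, A (c i)⟫_ℂ‖ ≤ ‖c i‖ * ‖A (c i)‖ := norm_inner_le_norm _ _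
    _ ≤ ‖c i‖ * (‖A‖ * ‖c i‖) := by gcongr; exact A.le_opNorm _
    _ = ‖A‖ * ‖c i‖ ^ 2 := by ring

omit [CompleteSpace H] in
theorem isPos_ketBra (φ : H) : IsPos (ketBra φ φ) := fun v => by
  rw [ketBra_apply, inner_smul_right, ← inner_conj_symm φ v, ← Complex.normSq_eq_conj_mul_self]
  exact_mod_cast Complex.normSq_nonneg _

theorem trace_ketBra (φ χ : H) : trace (ketBra φ χ : H →L[ℂ] H) = ⟪χ, φ⟫_ℂ := by
  rw [trace_eq_traceMul_id, traceMul_ketBra]; rfl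

theorem trace_ketBra_self (φ : H) : trace (ketBra φ φ : H →L[ℂ] H) = ((‖φ‖ ^ 2 : ℝ) : ℂ) := by
  rw [trace_ketBra, inner_self_eq_norm_sq_to_K]; simp

theorem isState_ketBra {φ : H} (hφ : ‖φ‖ = 1) : IsState (ketBra φ φ) :=
  ⟨isPos_ketBra φ, by simp [trace_ketBra_self, hφ]⟩

omit [CompleteSpace H] in
theorem ketBra_add_left (φ φ' χ : H) : ketBra (φ + φ') χ = ketBra φ χ + ketBra φ' χ :=
  Subtype.ext (ContinuousLinearMap.ext fun x => by simp [ketBra_apply])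

omit [CompleteSpace H] in
theorem ketBra_add_right (φ χ χ' : H) : ketBra φ (χ + χ') = ketBra φ χ + ketBra φ χ' :=
  Subtype.ext (ContinuousLinearMap.ext fun x => by simp [ketBra_apply, add_smul])

omit [CompleteSpace H] in
theorem ketBra_smul_left (z : ℂ) (φ χ : H) : ketBra (z • φ) χ = z • ketBra φ χ :=
  Subtype.ext (ContinuousLinearMap.ext fun x => by simp [ketBra_apply, smul_comm z])

omit [CompleteSpace H] in
theorem ketBra_smul_right (z : ℂ) (φ χ : H) :
    ketBra φ (z • χ) = (starRingEnd ℂ) z • ketBra φ χ :=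
  Subtype.ext (ContinuousLinearMap.ext fun x => by simp [ketBra_apply, mul_smul, smul_comm ⟪χ, x⟫_ℂ])

end TraceTheory
-- Functionals on the trace class that are bounded on states
section BoundedFunctionals

variable {H : Type*} [NormedAddCommGroup H] [InnerProductSpace ℂ H]

/-- Polarization produces $\|a\|^2+\|b\|^2$; balancing the two factors first turns this into a
multiple of $\|a\|\|b\|$. -/
theorem exists_rescale (a b : H) : ∃ a' b' : H, ‖a'‖ ^ 2 = ‖a‖ * ‖b‖ ∧ ‖b'‖ ^ 2 = ‖a‖ * ‖b‖ ∧
    ketBra a' b' = ketBra a b := by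
  by_cases h : a = 0 ∨ b = 0
  · refine ⟨0, 0, ?_, ?_, ?_⟩
    · rcases h with h | h <;> simp [h]
    · rcases h with h | h <;> simp [h]
    · refine Subtype.ext (ContinuousLinearMap.ext fun x => ?_)
      rcases h with h | h <;> simp [h, ketBra_apply]
  · push Not at h
    have ha : 0 < ‖a‖ := norm_pos_iff.mpr h.1
    have hb : 0 < ‖b‖ := norm_pos_iff.mpr h.2
    obtain ⟨t, ht, hts⟩ : ∃ t : ℝ, 0 < t ∧ t ^ 2 = ‖b‖ / ‖a‖ :=
      ⟨√(‖b‖ / ‖a‖), by positivity, Real.sq_sqrt (by positivity)⟩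
    refine ⟨(t : ℂ) • a, ((t⁻¹ : ℝ) : ℂ) • b, ?_, ?_, ?_⟩
    · rw [norm_smul, mul_pow, Complex.norm_real, Real.norm_eq_abs, sq_abs, hts]; field_simp
    · rw [norm_smul, mul_pow, Complex.norm_real, Real.norm_eq_abs, sq_abs, inv_pow, hts]
      field_simp
    · rw [ketBra_smul_left, ketBra_smul_right, smul_smul, Complex.conj_ofReal, ← Complex.ofReal_mul,
        mul_inv_cancel₀ ht.ne', Complex.ofReal_one, one_smul]

theorem ketBra_polarization (a b : H) :
    (4 : ℂ) • ketBra a b = ketBra (a + b) (a + b) - ketBra (a - b) (a - b) +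
      Complex.I • ketBra (a + Complex.I • b) (a + Complex.I • b) -
      Complex.I • ketBra (a - Complex.I • b) (a - Complex.I • b) := by
  simp only [sub_eq_add_neg, ← neg_one_smul ℂ b, ← neg_one_smul ℂ (Complex.I • b),
    ketBra_add_left, ketBra_add_right, ketBra_smul_left, ketBra_smul_right, smul_smul, smul_add,
    map_neg, map_one, Complex.conj_I]
  match_scalars <;> ring_nf <;> (simp; try norm_num)

theorem ketBra_apply_polarization (a b x : H) :
    ⟪b, x⟫_ℂ • a = (4⁻¹ : ℂ) • (⟪a + b, x⟫_ℂ • (a + b) - ⟪a - b, x⟫_ℂ • (a - b) +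
      Complex.I • ⟪a + Complex.I • b, x⟫_ℂ • (a + Complex.I • b) -
      Complex.I • ⟪a - Complex.I • b, x⟫_ℂ • (a - Complex.I • b)) := by
  have h := congrArg (fun T : traceClass H => (T : H →L[ℂ] H) x) (ketBra_polarization a b)
  simp only [Submodule.coe_smul, Submodule.coe_add, Submodule.coe_sub, smul_apply, add_apply,
    sub_apply, ketBra_apply] at h
  rw [← h, smul_smul]; norm_num

variable [CompleteSpace H]

theorem exists_nuclear {a b : ℕ → H} (hab : Summable (fun n => ‖a n‖ * ‖b n‖)) :
    ∃ T : traceClass H, ∀ x, HasSum (fun n => ⟪b n, x⟫_ℂ • a n) ((T : H →L[ℂ] H) x) := by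
  have hs : Summable (fun n => InnerProductSpace.rankOne ℂ (a n) (b n)) :=
    Summable.of_norm (by simpa using hab)
  have h : ∀ x, HasSum (fun n => ⟪b n, x⟫_ℂ • a n)
      ((∑' n, InnerProductSpace.rankOne ℂ (a n) (b n)) x) := fun x => by
    simpa using hs.hasSum.mapL (ContinuousLinearMap.apply ℂ H x)
  exact ⟨⟨_, a, b, hab, h⟩, h⟩

omit [CompleteSpace H] in
theorem isPos_of_hasSum {ι : Type*} {c : ι → H} {T : traceClass H}
    (hT : ∀ x, HasSum (fun n => ⟪c n, x⟫_ℂ • c n) ((T : H →L[ℂ] H) x)) : IsPos T := fun v => by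
  have h := (hT v).mapL (innerSL ℂ v)
  refine h.nonneg fun n => ?_
  have := isPos_ketBra (c n) v
  rwa [ketBra_apply] at this

theorem exists_isPos_nuclear {c : ℕ → H} (hc : Summable (fun n => ‖c n‖ ^ 2)) :
    ∃ T : traceClass H, IsPos T ∧
      ∀ x, HasSum (fun n => ⟪c n, x⟫_ℂ • c n) ((T : H →L[ℂ] H) x) := by
  obtain ⟨T, hT⟩ := exists_nuclear (a := c) (b := c) (by simpa only [← sq] using hc)
  exact ⟨T, isPos_of_hasSum hT, hT⟩

/-- Polarizing each term of a balanced nuclear series gives four positive nuclear series. They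
converge because $\|a'+zb'\|^2\le 2\|a'\|^2+2\|b'\|^2=4\|a\|\|b\|$ for $|z|=1$. -/
theorem span_isPos_eq_top : Submodule.span ℂ {T : traceClass H | IsPos T} = ⊤ := by
  refine eq_top_iff.mpr fun T _ => ?_
  obtain ⟨a, b, hab, hT⟩ := T.2
  choose a' b' ha hb hk using fun n => exists_rescale (a n) (b n)
  have hk' : ∀ n x, ⟪b n, x⟫_ℂ • a n = ⟪b' n, x⟫_ℂ • a' n := fun n x => by
    rw [← ketBra_apply, ← ketBra_apply, hk]
  have key : ∀ z : ℂ, ‖z‖ = 1 → ∃ S : traceClass H, IsPos S ∧ ∀ x,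
      HasSum (fun n => ⟪a' n + z • b' n, x⟫_ℂ • (a' n + z • b' n)) ((S : H →L[ℂ] H) x) := by
    intro z hz
    refine exists_isPos_nuclear ((hab.mul_left 4).of_nonneg_of_le (fun _ => by positivity)
      fun n => ?_)
    have h1 : ‖a' n + z • b' n‖ ≤ ‖a' n‖ + ‖b' n‖ := by
      simpa [norm_smul, hz] using norm_add_le (a' n) (z • b' n)
    nlinarith [sq_nonneg (‖a' n‖ - ‖b' n‖), ha n, hb n, norm_nonneg (a' n + z • b' n)]
  obtain ⟨S₀, h₀, hS₀⟩ := key 1 (by simp)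
  obtain ⟨S₁, h₁, hS₁⟩ := key (-1) (by simp)
  obtain ⟨S₂, h₂, hS₂⟩ := key Complex.I (by simp)
  obtain ⟨S₃, h₃, hS₃⟩ := key (-Complex.I) (by simp)
  have hTS : T = (4⁻¹ : ℂ) • (S₀ - S₁ + Complex.I • S₂ - Complex.I • S₃) := by
    refine Subtype.ext (ContinuousLinearMap.ext fun x => (hT x).unique ?_)
    have h := ((((hS₀ x).sub (hS₁ x)).add ((hS₂ x).const_smul Complex.I)).sub
      ((hS₃ x).const_smul Complex.I)).const_smul (4⁻¹ : ℂ)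
    convert h using 2 with n
    · rw [hk', ketBra_apply_polarization]
      simp only [one_smul, neg_smul, ← sub_eq_add_neg]
    · rfl
  rw [hTS]
  have hm : ∀ {S : traceClass H}, IsPos S → S ∈ Submodule.span ℂ {T : traceClass H | IsPos T} :=
    fun h => Submodule.subset_span h
  exact Submodule.smul_mem _ _ (sub_mem (add_mem (sub_mem (hm h₀) (hm h₁))
    (Submodule.smul_mem _ _ (hm h₂))) (Submodule.smul_mem _ _ (hm h₃)))

theorem IsPos.trace_eq {T : traceClass H} (hT : IsPos T) :
    0 ≤ (trace (T : H →L[ℂ] H)).re ∧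
      trace (T : H →L[ℂ] H) = ((trace (T : H →L[ℂ] H)).re : ℂ) := by
  have h := Complex.nonneg_iff.mp (trace_nonneg hT)
  exact ⟨h.1, Complex.ext rfl (by simp [← h.2])⟩

theorem IsPos.eq_zero_or {T : traceClass H} (hT : IsPos T) :
    T = 0 ∨ 0 < (trace (T : H →L[ℂ] H)).re ∧
      ∃ ρ : traceClass H, IsState ρ ∧ T = ((trace (T : H →L[ℂ] H)).re : ℂ) • ρ := by
  obtain ⟨h0, h1⟩ := hT.trace_eq
  rcases h0.eq_or_lt with h | h
  · left
    obtain ⟨ι, c, hc, hx⟩ := hT.exists_hasSum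
    rw [← h, hasSum_zero_iff_of_nonneg fun _ => by positivity] at hc
    have hc' : ∀ i, c i = 0 := fun i => by simpa using congrFun hc i
    refine Subtype.ext (ContinuousLinearMap.ext fun x => (hx x).unique ?_)
    simp [hc', hasSum_zero]
  · right
    set t := (trace (T : H →L[ℂ] H)).re with ht
    have ht0 : (t : ℂ) ≠ 0 := by exact_mod_cast h.ne'
    refine ⟨h, ((t⁻¹ : ℝ) : ℂ) • T, ⟨fun v => ?_, ?_⟩, ?_⟩
    · rw [Submodule.coe_smul, smul_apply, inner_smul_right]
      exact mul_nonneg (by exact_mod_cast (inv_pos.mpr h).le) (hT v)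
    · rw [trace_eq_traceMul_id, map_smul, ← trace_eq_traceMul_id, h1, smul_eq_mul]
      push_cast
      exact inv_mul_cancel₀ ht0
    · rw [smul_smul, Complex.ofReal_inv, mul_inv_cancel₀ ht0, one_smul]

theorem span_isState_eq_top : Submodule.span ℂ {T : traceClass H | IsState T} = ⊤ := by
  rw [eq_top_iff, ← span_isPos_eq_top, Submodule.span_le]
  intro T hT
  rcases IsPos.eq_zero_or hT with h | ⟨-, ρ, hρ, h⟩
  · rw [h]; exact zero_mem _
  · rw [h]; exact Submodule.smul_mem _ _ (Submodule.subset_span hρ)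

theorem IsPos.norm_apply_le {L : traceClass H →ₗ[ℂ] ℂ} {C : ℝ}
    (hL : ∀ ρ, IsState ρ → ‖L ρ‖ ≤ C) {T : traceClass H} (hT : IsPos T) :
    ‖L T‖ ≤ C * (trace (T : H →L[ℂ] H)).re := by
  rcases IsPos.eq_zero_or hT with h | ⟨h0, ρ, hρ, h⟩
  · subst h
    rw [trace_eq_traceMul_id]; simp
  · calc ‖L T‖ = ‖(trace (T : H →L[ℂ] H)).re‖ * ‖L ρ‖ := by
          conv_lhs => rw [h, map_smul, smul_eq_mul, norm_mul, Complex.norm_real]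
      _ = (trace (T : H →L[ℂ] H)).re * ‖L ρ‖ := by rw [Real.norm_of_nonneg h0.le]
      _ ≤ (trace (T : H →L[ℂ] H)).re * C := by gcongr; exact hL ρ hρ
      _ = _ := mul_comm _ _

/-- Each of the four positive terms of the polarization of a balanced pair contributes at most
$4C\|a\|\|b\|$; the identity then divides their sum by $4$. -/
theorem norm_apply_ketBra_le {L : traceClass H →ₗ[ℂ] ℂ} {C : ℝ} (hC : 0 ≤ C)
    (hL : ∀ ρ, IsState ρ → ‖L ρ‖ ≤ C) (a b : H) : ‖L (ketBra a b)‖ ≤ 4 * C * (‖a‖ * ‖b‖) := by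
  obtain ⟨a', b', ha, hb, hk⟩ := exists_rescale a b
  have hself : ∀ z : ℂ, ‖z‖ = 1 → ‖L (ketBra (a' + z • b') (a' + z • b'))‖ ≤
      C * (4 * (‖a‖ * ‖b‖)) := by
    intro z hz
    refine ((isPos_ketBra _).norm_apply_le hL).trans ?_
    rw [trace_ketBra_self, Complex.ofReal_re]
    gcongr
    have h1 : ‖a' + z • b'‖ ≤ ‖a'‖ + ‖b'‖ := by
      simpa [norm_smul, hz] using norm_add_le a' (z • b')
    nlinarith [sq_nonneg (‖a'‖ - ‖b'‖), norm_nonneg (a' + z • b')]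
  have h := congrArg L (ketBra_polarization a' b')
  rw [map_sub, map_add, map_sub, map_smul, map_smul, map_smul, hk] at h
  have h₀ := hself 1 (by simp)
  have h₁ := hself (-1) (by simp)
  have h₂ := hself Complex.I (by simp)
  have h₃ := hself (-Complex.I) (by simp)
  simp only [one_smul, neg_smul, ← sub_eq_add_neg] at h₀ h₁ h₂ h₃
  have hn := congrArg norm h
  simp only [smul_eq_mul, norm_mul] at hn
  have h4 : ‖(4 : ℂ)‖ = 4 := by simp
  rw [h4] at hn
  have e := (norm_sub_le _ _).trans (add_le_add_left ((norm_add_le _ _).trans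
    (add_le_add_left (norm_sub_le (L (ketBra (a' + b') (a' + b')))
      (L (ketBra (a' - b') (a' - b')))) ‖Complex.I * L (ketBra (a' + Complex.I • b')
        (a' + Complex.I • b'))‖)) ‖Complex.I * L (ketBra (a' - Complex.I • b')
        (a' - Complex.I • b'))‖)
  simp only [norm_mul, Complex.norm_I, one_mul] at e
  linarith

/-- A functional that is bounded on the states and vanishes on the pure states given by unit vectors
of a dense subspace is zero. -/
theorem eq_zero_of_bounded_of_dense {D : Submodule ℂ H} (hD : Dense (D : Set H))
    {L : traceClass H →ₗ[ℂ] ℂ} {C : ℝ} (hL : ∀ ρ, IsState ρ → ‖L ρ‖ ≤ C)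
    (h0 : ∀ φ ∈ D, ‖φ‖ = 1 → L (ketBra φ φ) = 0) : L = 0 := by
  -- On the zero space there are no states, so the bound does not by itself give `0 ≤ C`.
  wlog hC : 0 ≤ C generalizing C
  · exact this (C := |C|) (fun ρ hρ => (hL ρ hρ).trans (le_abs_self C)) (abs_nonneg C)
  have hD0 : ∀ φ ∈ D, L (ketBra φ φ) = 0 := by
    intro φ hφ
    by_cases hz : φ = 0
    · subst hz
      rw [show (0 : H) = (0 : ℂ) • 0 by simp, ketBra_smul_left, zero_smul, map_zero]
    · have hn : (‖φ‖ : ℂ) ≠ 0 := by exact_mod_cast norm_ne_zero_iff.mpr hz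
      have h1 := h0 (((‖φ‖⁻¹ : ℝ) : ℂ) • φ) (D.smul_mem _ hφ)
        (by rw [norm_smul, Complex.norm_real, norm_inv, norm_norm,
          inv_mul_cancel₀ (norm_ne_zero_iff.mpr hz)])
      rw [ketBra_smul_left, ketBra_smul_right, map_smul, map_smul, smul_smul, smul_eq_zero] at h1
      refine h1.resolve_left ?_
      simp [hz]
  have hc : ∀ c : H, L (ketBra c c) = 0 := by
    intro c
    -- The estimate compares $|c\rangle\langle c|$ with $|\varphi\rangle\langle\varphi|$ for
    -- $\varphi\in\mathcal D$. It is closed in $\varphi$, so it extends to all $\varphi$, and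
    -- $\varphi=c$ makes its right side zero.
    have hcl : IsClosed {φ : H | ‖L (ketBra c c)‖ ≤ 4 * C * (‖c - φ‖ * (‖c‖ + ‖φ‖))} :=
      isClosed_le continuous_const (by fun_prop)
    have hsub : (D : Set H) ⊆ {φ : H | ‖L (ketBra c c)‖ ≤ 4 * C * (‖c - φ‖ * (‖c‖ + ‖φ‖))} := by
      intro φ hφ
      have he : ketBra c c = ketBra (c - φ) c + ketBra φ (c - φ) + ketBra φ φ := by
        rw [add_assoc, ← ketBra_add_right, sub_add_cancel, ← ketBra_add_left, sub_add_cancel]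
      have h1 := norm_apply_ketBra_le hC hL (c - φ) c
      have h2 := norm_apply_ketBra_le hC hL φ (c - φ)
      rw [Set.mem_ofPred_eq, he, map_add, map_add, hD0 φ hφ, add_zero]
      refine (norm_add_le _ _).trans ?_
      linarith
    have := (hD.closure_eq ▸ closure_minimal hsub hcl) (Set.mem_univ c)
    simpa using this
  have hpos : ∀ T, IsPos T → L T = 0 := by
    intro T hT
    obtain ⟨ι, c, hsum, hx⟩ := hT.exists_hasSum
    -- Subtracting finitely many terms $|c_i\rangle\langle c_i|$ leaves $L(T)$ unchanged and the
    -- operator positive, while its trace, which controls $L$, tends to zero.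
    have hb : ∀ s : Finset ι,
        ‖L T‖ ≤ C * ((trace (T : H →L[ℂ] H)).re - ∑ i ∈ s, ‖c i‖ ^ 2) := by
      intro s
      have hp : IsPos (T - ∑ i ∈ s, ketBra (c i) (c i)) := by
        intro v
        have h1 := (hx v).mapL (innerSL ℂ v)
        have hn : ∀ i, 0 ≤ (innerSL ℂ v) (⟪c i, v⟫_ℂ • c i) := fun i => isPos_ketBra (c i) v
        have h2 := sum_le_hasSum s (fun i _ => hn i) h1
        have h3 : ⟪v, ((T - ∑ i ∈ s, ketBra (c i) (c i) : traceClass H) : H →L[ℂ] H) v⟫_ℂ =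
            (innerSL ℂ v) ((T : H →L[ℂ] H) v) - ∑ i ∈ s, (innerSL ℂ v) (⟪c i, v⟫_ℂ • c i) := by
          simp [ketBra_apply]
        rw [h3]
        exact sub_nonneg.mpr h2
      have h4 := hp.norm_apply_le hL
      have h5 : L (T - ∑ i ∈ s, ketBra (c i) (c i)) = L T := by simp [hc]
      have h6 : (trace ((T - ∑ i ∈ s, ketBra (c i) (c i) : traceClass H) : H →L[ℂ] H)).re =
          (trace (T : H →L[ℂ] H)).re - ∑ i ∈ s, ‖c i‖ ^ 2 := by
        rw [trace_eq_traceMul_id, map_sub, map_sum, Complex.sub_re, ← trace_eq_traceMul_id,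
          Complex.re_sum]
        congr 1
        refine Finset.sum_congr rfl fun i _ => ?_
        rw [← trace_eq_traceMul_id, trace_ketBra_self, Complex.ofReal_re]
      rwa [h5, h6] at h4
    have hlim : Tendsto (fun s : Finset ι => C * ((trace (T : H →L[ℂ] H)).re - ∑ i ∈ s, ‖c i‖ ^ 2))
        atTop (nhds (C * ((trace (T : H →L[ℂ] H)).re - (trace (T : H →L[ℂ] H)).re))) :=
      (Tendsto.const_sub _ hsum).const_mul C
    have := ge_of_tendsto' hlim hb
    simpa using this
  refine LinearMap.ext_on span_isPos_eq_top fun T hT => ?_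
  simpa using hpos T hT

end BoundedFunctionals
-- Contractivity of an instrument and its outcome probabilities
section InstrumentBounds

variable {X : Type*} [MeasurableSpace X] {H : Type*} [NormedAddCommGroup H]
  [InnerProductSpace ℂ H] [CompleteSpace H] (M : Instrument X H)

theorem IsState.isPos {ρ : traceClass H} (hρ : IsState ρ) : IsPos ρ := hρ.nonneg

theorem Instrument.isPos_op {F : Set X} (hF : MeasurableSet F) {T : traceClass H} (hT : IsPos T) :
    IsPos (M.op F T) := fun w => by
  have h := M.completelyPositive F hF 1 (fun _ _ => T) (fun v => by simpa using hT (v 0))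
    (fun _ => w)
  simpa using h

theorem Instrument.trace_op_re_le {F : Set X} (hF : MeasurableSet F) {T : traceClass H}
    (hT : IsPos T) : (trace (M.op F T : H →L[ℂ] H)).re ≤ (trace (T : H →L[ℂ] H)).re := by
  -- Additivity over $F$ and its complement comes from σ-additivity after padding with empty sets.
  set G : ℕ → Set X := fun n => if n = 0 then F else if n = 1 then Fᶜ else ∅ with hG
  have hGm : ∀ n, MeasurableSet (G n) := fun n => by
    simp only [hG]; split_ifs
    exacts [hF, hF.compl, MeasurableSet.empty]
  have hGd : Pairwise (Function.onFun Disjoint G) := by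
    intro m n hmn
    simp only [Function.onFun, hG]
    split_ifs <;> simp_all [disjoint_compl_right, disjoint_compl_left]
  have hU : ⋃ n, G n = Set.univ := by
    refine Set.eq_univ_of_forall fun x => Set.mem_iUnion.mpr ?_
    by_cases hx : x ∈ F
    · exact ⟨0, by simpa [hG] using hx⟩
    · exact ⟨1, by simpa [hG] using hx⟩
  have h := Complex.hasSum_re (M.hasSum_trace_op T hGm hGd)
  rw [hU, M.tracePreserving] at h
  have := sum_le_hasSum {0} (fun n _ => ((M.isPos_op (hGm n) hT).trace_eq).1) h
  simpa [hG] using this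

theorem Instrument.norm_traceMul_op_le {F : Set X} (hF : MeasurableSet F) (A : H →L[ℂ] H)
    {ρ : traceClass H} (hρ : IsState ρ) : ‖traceMul A (M.op F ρ)‖ ≤ ‖A‖ := by
  refine ((M.isPos_op hF hρ.isPos).norm_traceMul_le A).trans ?_
  have h := M.trace_op_re_le hF hρ.isPos
  rw [hρ.trace_eq_one, Complex.one_re] at h
  exact mul_le_of_le_one_right (norm_nonneg _) h

theorem Instrument.outcomeMeasure_apply {ρ : traceClass H} (hρ : IsState ρ) {F : Set X}
    (hF : MeasurableSet F) :
    M.outcomeMeasure ρ hρ F = ENNReal.ofReal (trace (M.op F ρ : H →L[ℂ] H)).re :=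
  Measure.ofMeasurable_apply F hF

instance Instrument.isProbabilityMeasure_outcomeMeasure {ρ : traceClass H} (hρ : IsState ρ) :
    IsProbabilityMeasure (M.outcomeMeasure ρ hρ) :=
  ⟨by rw [M.outcomeMeasure_apply hρ MeasurableSet.univ, M.tracePreserving, hρ.trace_eq_one]; simp⟩

theorem Instrument.trace_op_eq_real {ρ : traceClass H} (hρ : IsState ρ) {F : Set X}
    (hF : MeasurableSet F) :
    trace (M.op F ρ : H →L[ℂ] H) = ((M.outcomeMeasure ρ hρ).real F : ℂ) := by
  have h := (M.isPos_op hF hρ.isPos).trace_eq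
  rw [Measure.real, M.outcomeMeasure_apply hρ hF, ENNReal.toReal_ofReal h.1]
  exact h.2

end InstrumentBounds

/-! ### Posterior states of vectors in the domain -/

section Kraus

variable {X : Type*} [MeasurableSpace X] {H : Type*} [NormedAddCommGroup H]
  [InnerProductSpace ℂ H] [CompleteSpace H] {M : Instrument X H} {μ : Measure X}
  {D : Submodule ℂ H} {V : ℕ → X → D →ₗ[ℂ] H}

namespace KrausRepresentation

omit [CompleteSpace H] in
theorem tsum_inner_self (c : ℕ → H) :
    ∑' k, ⟪c k, c k⟫_ℂ = (((∑' k, ‖c k‖ₑ ^ 2).toReal : ℝ) : ℂ) := by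
  rw [ENNReal.tsum_toReal_eq fun _ => by finiteness, Complex.ofReal_tsum]
  refine tsum_congr fun k => ?_
  rw [inner_self_eq_norm_sq_to_K]; simp

theorem eq_zero_of_ketBra (hV : KrausRepresentation M μ D V) {L : traceClass H →ₗ[ℂ] ℂ} {C : ℝ}
    (hL : ∀ ρ, IsState ρ → ‖L ρ‖ ≤ C) (h0 : ∀ φ : D, ‖(φ : H)‖ = 1 → L (ketBra (φ : H) φ) = 0) :
    L = 0 :=
  eq_zero_of_bounded_of_dense hV.dense hL fun φ hφ => h0 ⟨φ, hφ⟩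

theorem traceMul_op_eq_zero (hV : KrausRepresentation M μ D V) {F : Set X} (hF : MeasurableSet F)
    (h : ∀ φ : D, ∀ᵐ x ∂μ.restrict F, ∀ k, V k x φ = 0) (A : H →L[ℂ] H) (T : traceClass H) :
    traceMul A (M.op F T) = 0 := by
  have : traceMul A ∘ₗ M.op F = 0 :=
    hV.eq_zero_of_ketBra (fun ρ hρ => M.norm_traceMul_op_le hF A hρ) fun φ _ => by
      rw [LinearMap.comp_apply, traceMul_apply, hV.trace_eq φ F hF A]
      refine integral_eq_zero_of_ae ?_
      filter_upwards [h φ] with x hx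
      simp [hx]
  exact LinearMap.congr_fun this T

/-- An explicit density is at hand only for vectors of $\mathcal D$; for a general state the density
principle still transfers null sets from $\mu$ to $\mu_\rho$. -/
theorem outcomeMeasure_absolutelyContinuous (hV : KrausRepresentation M μ D V) {ρ : traceClass H}
    (hρ : IsState ρ) : M.outcomeMeasure ρ hρ ≪ μ := by
  refine Measure.AbsolutelyContinuous.mk fun N hN h0 => ?_
  rw [M.outcomeMeasure_apply hρ hN, trace_eq_traceMul_id, hV.traceMul_op_eq_zero hN]
  · simp
  · intro φ
    rw [Measure.restrict_eq_zero.mpr h0]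
    simp

theorem aemeasurable_density (hV : KrausRepresentation M μ D V) (φ : D) :
    AEMeasurable (fun x => ∑' k, ‖V k x φ‖ₑ ^ 2) μ :=
  AEMeasurable.tsum fun k => ((hV.aestronglyMeasurable k φ).enorm.pow_const 2)

theorem density_lt_top (hV : KrausRepresentation M μ D V) (φ : D) :
    ∀ᵐ x ∂μ, ∑' k, ‖V k x φ‖ₑ ^ 2 < ∞ :=
  ae_lt_top' (hV.aemeasurable_density φ) (hV.lintegral_lt_top φ).ne

theorem trace_op_ketBra (hV : KrausRepresentation M μ D V) (φ : D) {F : Set X}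
    (hF : MeasurableSet F) : trace (M.op F (ketBra (φ : H) φ) : H →L[ℂ] H) =
      (((∫⁻ x in F, ∑' k, ‖V k x φ‖ₑ ^ 2 ∂μ).toReal : ℝ) : ℂ) := by
  have h := hV.trace_eq φ F hF (ContinuousLinearMap.id ℂ H)
  rw [ContinuousLinearMap.id_comp] at h
  rw [h, ← integral_toReal (hV.aemeasurable_density φ).restrict
    (ae_restrict_of_ae (hV.density_lt_top φ)), ← integral_complex_ofReal]
  exact integral_congr_ae (Eventually.of_forall fun x => tsum_inner_self _)

theorem outcomeMeasure_ketBra (hV : KrausRepresentation M μ D V) (φ : D)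
    (hφ : IsState (ketBra (φ : H) φ)) :
    M.outcomeMeasure (ketBra (φ : H) φ) hφ = μ.withDensity fun x => ∑' k, ‖V k x φ‖ₑ ^ 2 := by
  refine Measure.ext fun F hF => ?_
  rw [M.outcomeMeasure_apply hφ hF, withDensity_apply _ hF, hV.trace_op_ketBra φ hF,
    Complex.ofReal_re, ENNReal.ofReal_toReal]
  exact ((setLIntegral_le_lintegral _ _).trans_lt (hV.lintegral_lt_top φ)).ne

theorem lintegral_density (hV : KrausRepresentation M μ D V) (φ : D) :
    ∫⁻ x, ∑' k, ‖V k x φ‖ₑ ^ 2 ∂μ = ‖(φ : H)‖ₑ ^ 2 := by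
  have h := hV.trace_op_ketBra φ MeasurableSet.univ
  rw [M.tracePreserving, trace_ketBra_self, Measure.restrict_univ] at h
  have h' := Complex.ofReal_injective h
  rw [← ENNReal.ofReal_toReal (hV.lintegral_lt_top φ).ne, ← h', ENNReal.ofReal_pow (norm_nonneg _),
    ofReal_norm]

omit [InnerProductSpace ℂ H] [CompleteSpace H] in
theorem summable_sq {c : ℕ → H} (hc : ∑' k, ‖c k‖ₑ ^ 2 ≠ ∞) : Summable fun k => ‖c k‖ ^ 2 := by
  simpa using ENNReal.summable_toReal hc

/-- Irreducibility speaks about given posterior families, so one has to be exhibited. Where the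
density vanishes or is infinite the scalar is `0` and the value is no state; such outcomes are
$\mu_\rho$-null. -/
theorem exists_isPosteriorFamily (hV : KrausRepresentation M μ D V) (φ : D)
    (hφ : IsState (ketBra (φ : H) φ)) :
    ∃ S : X → traceClass H, (∀ᵐ x ∂μ, ∀ y,
      HasSum (fun k => ⟪V k x φ, y⟫_ℂ • V k x φ) ((S x : H →L[ℂ] H) y)) ∧
      M.IsPosteriorFamily (ketBra (φ : H) φ) hφ
        fun x => (((∑' k, ‖V k x φ‖ₑ ^ 2).toReal⁻¹ : ℝ) : ℂ) • S x := by
  have hex : ∀ x, ∃ S : traceClass H, ∑' k, ‖V k x φ‖ₑ ^ 2 < ∞ → ∀ y,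
      HasSum (fun k => ⟪V k x φ, y⟫_ℂ • V k x φ) ((S : H →L[ℂ] H) y) := by
    intro x
    by_cases h : ∑' k, ‖V k x φ‖ₑ ^ 2 < ∞
    · obtain ⟨S, -, hS⟩ := exists_isPos_nuclear (summable_sq h.ne)
      exact ⟨S, fun _ => hS⟩
    · exact ⟨0, fun h' => absurd h' h⟩
  choose S hS using hex
  have hfin := hV.density_lt_top φ
  have htr : ∀ x, ∑' k, ‖V k x φ‖ₑ ^ 2 < ∞ → ∀ A,
      traceMul A (S x) = ∑' k, ⟪V k x φ, A (V k x φ)⟫_ℂ := fun x hx A =>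
    (IsPos.hasSum_traceMul (summable_sq hx.ne).hasSum (hS x hx) A).tsum_eq.symm
  have hac := hV.outcomeMeasure_absolutelyContinuous hφ
  refine ⟨S, hfin.mono hS, ?_, fun A => ?_, fun F hF A => ?_⟩
  · have h0 : ∀ᵐ x ∂M.outcomeMeasure _ hφ, ∑' k, ‖V k x φ‖ₑ ^ 2 ≠ 0 := by
      rw [hV.outcomeMeasure_ketBra φ hφ, ae_withDensity_iff' (hV.aemeasurable_density φ)]
      exact Eventually.of_forall fun _ h => h
    filter_upwards [h0, hac.ae_le hfin] with x hx0 hx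
    have ht := ENNReal.toReal_pos hx0 hx.ne
    refine ⟨fun v => ?_, ?_⟩
    · rw [Submodule.coe_smul, smul_apply, inner_smul_right]
      exact mul_nonneg (by exact_mod_cast (inv_pos.mpr ht).le) (isPos_of_hasSum (hS x hx) v)
    · rw [trace_eq_traceMul_id, map_smul, htr x hx]
      simp only [ContinuousLinearMap.id_apply]
      rw [tsum_inner_self, smul_eq_mul, ← Complex.ofReal_mul, inv_mul_cancel₀ ht.ne',
        Complex.ofReal_one]
  · refine AEMeasurable.mono_ac ?_ hac
    have hm : AEMeasurable (fun x => (((∑' k, ‖V k x φ‖ₑ ^ 2).toReal⁻¹ : ℝ) : ℂ) *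
        ∑' k, ⟪V k x φ, A (V k x φ)⟫_ℂ) μ := by
      refine AEMeasurable.mul ?_ ?_
      · exact Complex.measurable_ofReal.comp_aemeasurable
          (hV.aemeasurable_density φ).ennreal_toReal.inv
      · refine AEMeasurable.tsum fun k => AEStronglyMeasurable.aemeasurable ?_
        exact (hV.aestronglyMeasurable k φ).inner
          (A.continuous.comp_aestronglyMeasurable (hV.aestronglyMeasurable k φ))
    refine hm.congr ?_
    filter_upwards [hfin] with x hx
    rw [← htr x hx, ← smul_eq_mul, ← map_smul, traceMul_apply]
  · rw [hV.outcomeMeasure_ketBra φ hφ, hV.trace_eq φ F hF A, restrict_withDensity hF,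
      integral_withDensity_eq_integral_toReal_smul₀ (hV.aemeasurable_density φ).restrict
        (ae_restrict_of_ae hfin)]
    refine integral_congr_ae (ae_restrict_of_ae ?_)
    filter_upwards [hfin] with x hx
    have e := htr x hx A
    rw [← traceMul_apply, map_smul, e, Complex.real_smul, smul_eq_mul, ← mul_assoc,
      ← Complex.ofReal_mul]
    by_cases h0 : ∑' k, ‖V k x φ‖ₑ ^ 2 = 0
    · have hz : ∀ k, V k x φ = 0 := by simpa using h0
      simp [hz]
    · rw [mul_inv_cancel₀ (ENNReal.toReal_pos h0 hx.ne).ne', Complex.ofReal_one, one_mul]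

/-- Purity makes $S_x$ a multiple of $|u\rangle\langle u|$. The part $v$ of $V_k\varphi$ orthogonal
to $u$ has $0=\langle v,S_xv\rangle=\sum_j|\langle V_j\varphi,v\rangle|^2$; so $v$ is orthogonal to
both $V_k\varphi$ and $u$, hence to itself. -/
theorem ae_exists_smul_of_norm_eq_one (hV : KrausRepresentation M μ D V) (hirr : M.IsIrreducible)
    (φ : D) (hφ : ‖(φ : H)‖ = 1) : ∀ᵐ x ∂μ, ∃ u : H, ∀ k, ∃ z : ℂ, V k x φ = z • u := by
  have hst := isState_ketBra hφ
  obtain ⟨S, hS, hr⟩ := hV.exists_isPosteriorFamily φ hst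
  have h := hirr _ hst ⟨φ, hφ, rfl⟩ _ hr
  rw [hV.outcomeMeasure_ketBra φ hst, ae_withDensity_iff' (hV.aemeasurable_density φ)] at h
  filter_upwards [h, hS, hV.density_lt_top φ] with x hx hSx hfin
  by_cases h0 : ∑' k, ‖V k x φ‖ₑ ^ 2 = 0
  · exact ⟨0, fun k => ⟨0, by simpa using (ENNReal.tsum_eq_zero.mp h0 k)⟩⟩
  · obtain ⟨u, hu, hru⟩ := hx h0
    have ht : ((∑' k, ‖V k x φ‖ₑ ^ 2).toReal : ℂ) ≠ 0 := by
      exact_mod_cast (ENNReal.toReal_pos h0 hfin.ne).ne'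
    refine ⟨u, fun k => ⟨⟪u, V k x φ⟫_ℂ, ?_⟩⟩
    have huu : ⟪u, u⟫_ℂ = 1 := by rw [inner_self_eq_norm_sq_to_K, hu]; simp
    set v := V k x φ - ⟪u, V k x φ⟫_ℂ • u with hv
    have huv : ⟪u, v⟫_ℂ = 0 := by rw [hv, inner_sub_right, inner_smul_right, huu]; simp
    have hSv : (S x : H →L[ℂ] H) v = 0 := by
      have := congrArg (fun T : traceClass H => (T : H →L[ℂ] H) v) hru
      simpa [ketBra_apply, huv, (ENNReal.toReal_pos h0 hfin.ne).ne'] using this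
    have hsum := (hSx v).mapL (innerSL ℂ v)
    rw [hSv, map_zero, hasSum_zero_iff_of_nonneg fun j => ?_] at hsum
    · have hk : ⟪V k x φ, v⟫_ℂ * ⟪v, V k x φ⟫_ℂ = 0 := by
        simpa [inner_smul_right] using congrFun hsum k
      have hk' : ⟪V k x φ, v⟫_ℂ = 0 := by
        rcases mul_eq_zero.mp hk with h | h
        · exact h
        · exact inner_eq_zero_symm.mp h
      have hvv : ⟪v, v⟫_ℂ = 0 := by
        conv_lhs => rw [hv]
        rw [inner_sub_left, inner_smul_left, hk', huv]; simp
      exact sub_eq_zero.mp (inner_self_eq_zero.mp hvv)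
    · exact isPos_ketBra (V j x φ) v

theorem ae_exists_smul (hV : KrausRepresentation M μ D V) (hirr : M.IsIrreducible)
    (φ : D) : ∀ᵐ x ∂μ, ∃ u : H, ∀ k, ∃ z : ℂ, V k x φ = z • u := by
  by_cases hz : φ = 0
  · subst hz
    exact Eventually.of_forall fun x => ⟨0, fun k => ⟨0, by simp⟩⟩
  · have hn : ‖(φ : H)‖ ≠ 0 := by simpa using hz
    have h := hV.ae_exists_smul_of_norm_eq_one hirr (((‖(φ : H)‖⁻¹ : ℝ) : ℂ) • φ) (by
      rw [Submodule.coe_smul, norm_smul, Complex.norm_real, norm_inv, norm_norm,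
        inv_mul_cancel₀ hn])
    filter_upwards [h] with x ⟨u, hu⟩
    refine ⟨u, fun k => ?_⟩
    obtain ⟨z, hz⟩ := hu k
    refine ⟨(‖(φ : H)‖ : ℂ) * z, ?_⟩
    rw [mul_smul, ← hz, map_smul, smul_smul, ← Complex.ofReal_mul, mul_inv_cancel₀ hn,
      Complex.ofReal_one, one_smul]

theorem exists_seq_span (hV : KrausRepresentation M μ D V) :
    ∃ f : ℕ → D, Submodule.span ℂ (Set.range f) = ⊤ := by
  obtain ⟨s, hs, hspan⟩ := hV.countable_span
  have hsD : s ⊆ D := hspan ▸ Submodule.subset_span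
  -- Adding `0` makes the spanning set nonempty, hence the range of a sequence.
  set t : Set D := insert 0 (Subtype.val ⁻¹' s) with ht
  have htc : t.Countable := (hs.preimage Subtype.val_injective).insert 0
  obtain ⟨f, hf⟩ := htc.exists_eq_range ⟨0, Set.mem_insert _ _⟩
  refine ⟨f, ?_⟩
  rw [← hf, ht, Submodule.span_insert_zero]
  refine Submodule.map_injective_of_injective D.injective_subtype ?_
  rw [Submodule.map_span, Submodule.map_subtype_top]
  rw [D.coe_subtype, show ((↑) : D → H) '' ((↑) ⁻¹' s) = s from
    (Subtype.image_preimage_coe _ _).trans (Set.inter_eq_right.mpr hsD), hspan]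

end KrausRepresentation

end Kraus

/-! ### Locally linearly dependent operators -/

section LocallyDependent

variable {E : Type*} [AddCommGroup E] [Module ℂ E] {H : Type*}

/-- A quadratic form vanishes once its polar form vanishes on a spanning set, and the polar form at
$(f_i,f_j)$ is read off from the values at $f_i$, $f_j$ and $f_i+f_j$. This replaces uncountably
many null sets by countably many. -/
theorem quadratic_eq_zero_of_span {a₁ a₂ b₁ b₂ : E →ₗ[ℂ] ℂ} {f : ℕ → E}
    (hf : Submodule.span ℂ (Set.range f) = ⊤)
    (h1 : ∀ i, a₁ (f i) * b₂ (f i) = a₂ (f i) * b₁ (f i))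
    (h2 : ∀ i j, a₁ (f i + f j) * b₂ (f i + f j) = a₂ (f i + f j) * b₁ (f i + f j)) (φ : E) :
    a₁ φ * b₂ φ = a₂ φ * b₁ φ := by
  have key : ∀ φ χ : E, a₁ φ * b₂ χ + a₁ χ * b₂ φ = a₂ φ * b₁ χ + a₂ χ * b₁ φ := by
    intro φ χ
    have hφ : φ ∈ Submodule.span ℂ (Set.range f) := hf ▸ Submodule.mem_top
    have hχ : χ ∈ Submodule.span ℂ (Set.range f) := hf ▸ Submodule.mem_top
    induction hφ, hχ using Submodule.span_induction₂ with
    | mem_mem x y hx hy =>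
      obtain ⟨i, rfl⟩ := hx
      obtain ⟨j, rfl⟩ := hy
      have h := h2 i j
      simp only [map_add] at h
      linear_combination h - h1 i - h1 j
    | zero_left y hy => simp
    | zero_right x hx => simp
    | add_left x y z _ _ _ hx hy => simp only [map_add]; linear_combination hx + hy
    | add_right x y z _ _ _ hx hy => simp only [map_add]; linear_combination hx + hy
    | smul_left r x y _ _ h => simp only [map_smul, smul_eq_mul]; linear_combination r * h
    | smul_right r x y _ _ h => simp only [map_smul, smul_eq_mul]; linear_combination r * h
  linear_combination (1 / 2 : ℂ) * key φ φ

/-- Parallelism of $A\varphi$ and $B\varphi$ is the vanishing of all minors $\langle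
p,A\varphi\rangle\langle q,B\varphi\rangle-\langle q,A\varphi\rangle\langle p,B\varphi\rangle$, each
quadratic in $\varphi$. -/
theorem exists_smul_of_span [NormedAddCommGroup H] [InnerProductSpace ℂ H] {A B : E →ₗ[ℂ] H}
    {f : ℕ → E} (hf : Submodule.span ℂ (Set.range f) = ⊤)
    (h1 : ∀ i, ∃ (u : H) (y z : ℂ), A (f i) = y • u ∧ B (f i) = z • u)
    (h2 : ∀ i j, ∃ (u : H) (y z : ℂ), A (f i + f j) = y • u ∧ B (f i + f j) = z • u)
    (φ : E) (hφ : A φ ≠ 0) : ∃ c : ℂ, B φ = c • A φ := by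
  have aux : ∀ χ, (∃ (u : H) (y z : ℂ), A χ = y • u ∧ B χ = z • u) → ∀ p q : H,
      ⟪p, A χ⟫_ℂ * ⟪q, B χ⟫_ℂ = ⟪q, A χ⟫_ℂ * ⟪p, B χ⟫_ℂ := by
    rintro χ ⟨u, y, z, hA, hB⟩ p q
    rw [hA, hB]
    simp only [inner_smul_right]; ring
  have key : ∀ p q : H, ⟪p, A φ⟫_ℂ * ⟪q, B φ⟫_ℂ = ⟪q, A φ⟫_ℂ * ⟪p, B φ⟫_ℂ := fun p q =>
    quadratic_eq_zero_of_span (a₁ := (innerSL ℂ p : H →ₗ[ℂ] ℂ) ∘ₗ A)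
      (a₂ := (innerSL ℂ q : H →ₗ[ℂ] ℂ) ∘ₗ A) (b₁ := (innerSL ℂ p : H →ₗ[ℂ] ℂ) ∘ₗ B)
      (b₂ := (innerSL ℂ q : H →ₗ[ℂ] ℂ) ∘ₗ B) hf (fun i => aux _ (h1 i) p q)
      (fun i j => aux _ (h2 i j) p q) φ
  have hne : ⟪A φ, A φ⟫_ℂ ≠ 0 := inner_self_ne_zero.mpr hφ
  refine ⟨⟪A φ, B φ⟫_ℂ / ⟪A φ, A φ⟫_ℂ, ext_inner_left ℂ fun p => ?_⟩
  rw [inner_smul_right]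
  field_simp
  linear_combination -key p (A φ)

/-- Two locally linearly dependent operators that are not proportional have their ranges in a common
line. -/
theorem exists_smul_of_locally_dependent [AddCommGroup H] [Module ℂ H] {A B : E →ₗ[ℂ] H}
    (h : ∀ φ, A φ ≠ 0 → ∃ c : ℂ, B φ = c • A φ) (hne : ∀ c : ℂ, B ≠ c • A) {φ₀ : E}
    (h0 : A φ₀ ≠ 0) (φ : E) : (∃ z : ℂ, A φ = z • A φ₀) ∧ ∃ z : ℂ, B φ = z • A φ₀ := by
  obtain ⟨c, hc⟩ := h φ₀ h0
  have hA : ∀ φ, ∃ z : ℂ, A φ = z • A φ₀ := by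
    by_contra! hex
    obtain ⟨χ, hχ⟩ := hex
    -- When $A\varphi$ and $A\varphi_0$ are independent, the factor at $\varphi+\varphi_0$ must
    -- equal both the factor at $\varphi$ and the factor `c` at $\varphi_0$.
    have step : ∀ φ, (∀ z : ℂ, A φ ≠ z • A φ₀) → B φ = c • A φ := by
      intro φ hφ
      obtain ⟨d, hd⟩ := h φ fun h' => hφ 0 (by simp [h'])
      obtain ⟨e, he⟩ := h (φ + φ₀) fun h' => hφ (-1) (by
        rw [map_add] at h'; rw [neg_one_smul]; exact eq_neg_of_add_eq_zero_left h')
      rw [map_add, map_add, hd, hc, smul_add] at he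
      have h1 : (d - e) • A φ = (e - c) • A φ₀ := by
        rw [sub_smul, sub_smul, sub_eq_sub_iff_add_eq_add, he, add_comm]
      have hde : d - e = 0 := by
        by_contra hde
        refine hφ ((d - e)⁻¹ * (e - c)) ?_
        rw [mul_smul, ← h1, smul_smul, inv_mul_cancel₀ hde, one_smul]
      rw [hde, zero_smul, eq_comm, smul_eq_zero] at h1
      have hec := h1.resolve_right h0
      rw [hd, show d = c by linear_combination hde + hec]
    refine hne c (LinearMap.ext fun φ => ?_)
    rw [LinearMap.smul_apply]
    by_cases hφ : ∀ z : ℂ, A φ ≠ z • A φ₀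
    · exact step φ hφ
    · push Not at hφ
      obtain ⟨z, hz⟩ := hφ
      -- For $A\varphi$ on the line, adding $\chi$ moves it off the line; $B=cA$ holds at
      -- $\varphi+\chi$ and at $\chi$, hence at $\varphi$.
      have h1 := step (φ + χ) fun w hw => hχ (w - z) (by
        rw [map_add, hz] at hw
        rw [sub_smul, ← hw, add_sub_cancel_left])
      rw [map_add, map_add, smul_add, step χ hχ] at h1
      exact add_right_cancel h1
  refine ⟨hA φ, ?_⟩
  obtain ⟨s, hs⟩ := hA φ
  -- The shift makes the value of $A$ equal to $A\varphi_0\ne0$, so local dependence applies even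
  -- where $A\varphi=0$.
  have hA1 : A (φ + (1 - s) • φ₀) = A φ₀ := by
    rw [map_add, map_smul, hs, ← add_smul, add_sub_cancel, one_smul]
  obtain ⟨d, hd⟩ := h (φ + (1 - s) • φ₀) (by rwa [hA1])
  rw [hA1, map_add, map_smul, hc, smul_smul] at hd
  exact ⟨d - (1 - s) * c, by rw [sub_smul, ← hd, add_sub_cancel_right]⟩

end LocallyDependent

/-! ### The common range line -/

section CommonRange

variable {X : Type*} [MeasurableSpace X] {H : Type*} [NormedAddCommGroup H]
  [InnerProductSpace ℂ H] [CompleteSpace H] {M : Instrument X H} {μ : Measure X}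
  {D : Submodule ℂ H} {V : ℕ → X → D →ₗ[ℂ] H}

/-- Each $V_k$ with $k>0$ is paired with $V_0$; $V_0$ itself needs a non-proportional partner, and
on $F_s$ this is $V_1$. -/
theorem KrausRepresentation.ae_exists_smul_zero (hV : KrausRepresentation M μ D V)
    (hirr : M.IsIrreducible) : ∀ᵐ x ∂μ, V 1 x ≠ 0 → ∀ φ₀, V 0 x φ₀ ≠ 0 → ∀ k φ, ∃ z : ℂ,
      V k x φ = z • V 0 x φ₀ := by
  obtain ⟨f, hf⟩ := hV.exists_seq_span
  have h1 := ae_all_iff.mpr fun i => hV.ae_exists_smul hirr (f i)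
  have h2 := ae_all_iff.mpr fun i => ae_all_iff.mpr fun j => hV.ae_exists_smul hirr (f i + f j)
  filter_upwards [h1, h2, hV.not_proportional] with x h1 h2 hnp hV1 φ₀ h0
  have hdep : ∀ k φ, V 0 x φ ≠ 0 → ∃ c : ℂ, V k x φ = c • V 0 x φ := fun k =>
    exists_smul_of_span hf
      (fun i => (h1 i).imp fun u hu => ⟨_, _, (hu 0).choose_spec, (hu k).choose_spec⟩)
      (fun i j => (h2 i j).imp fun u hu => ⟨_, _, (hu 0).choose_spec, (hu k).choose_spec⟩)
  have hV0 : V 0 x ≠ 0 := fun h => h0 (by simp [h])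
  intro k φ
  by_cases hk : V k x = 0
  · exact ⟨0, by simp [hk]⟩
  rcases Nat.eq_zero_or_pos k with rfl | hk0
  · exact (exists_smul_of_locally_dependent (hdep 1) (hnp 0 1 (by simp) hV0 hV1) h0 φ).1
  · exact (exists_smul_of_locally_dependent (hdep k) (hnp 0 k hk0.ne hV0 hk) h0 φ).2

end CommonRange
-- The measurable direction and the posterior state for arbitrary states
section PosteriorDirection

variable {X : Type*} [MeasurableSpace X] {H : Type*} [NormedAddCommGroup H]
  [InnerProductSpace ℂ H] [CompleteSpace H]

/-- The measure $\mu_\rho$ exists only for states, while the density principle needs a linear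
functional on the whole trace class. For simple $g$ the integral is a combination of traces, linear
in the operator; approximation converges on states, hence on their span, which is everything. -/
theorem Instrument.exists_integral_functional (M : Instrument X H) {F : Set X}
    (hF : MeasurableSet F) {g : X → ℂ} (hg : StronglyMeasurable g) {c : ℝ}
    (hc : ∀ x, ‖g x‖ ≤ c) : ∃ I : traceClass H →ₗ[ℂ] ℂ, ∀ ρ (hρ : IsState ρ),
      I ρ = ∫ x in F, g x ∂(M.outcomeMeasure ρ hρ) := by
  by_cases hX : IsEmpty X
  · refine ⟨0, fun ρ hρ => ?_⟩
    rw [Measure.eq_zero_of_isEmpty (M.outcomeMeasure ρ hρ)]; simp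
  obtain ⟨x₀⟩ := not_isEmpty_iff.mp hX
  have hc0 : 0 ≤ c := (norm_nonneg _).trans (hc x₀)
  set s : ℕ → SimpleFunc X ℂ := hg.approxBounded c with hs
  set I : ℕ → traceClass H →ₗ[ℂ] ℂ := fun n =>
    ∑ y ∈ (s n).range, y • (traceMul (ContinuousLinearMap.id ℂ H) ∘ₗ M.op (s n ⁻¹' {y} ∩ F))
    with hI
  have hIρ : ∀ n ρ (hρ : IsState ρ), I n ρ = ∫ x in F, s n x ∂(M.outcomeMeasure ρ hρ) := by
    intro n ρ hρ
    rw [← (s n).integral_eq_integral ((s n).integrable_of_isFiniteMeasure), SimpleFunc.integral_eq,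
      hI, LinearMap.sum_apply]
    refine Finset.sum_congr rfl fun y _ => ?_
    have hm : MeasurableSet (s n ⁻¹' {y} ∩ F) := ((s n).measurableSet_fiber y).inter hF
    rw [LinearMap.smul_apply, LinearMap.comp_apply, ← trace_eq_traceMul_id,
      M.trace_op_eq_real hρ hm, smul_eq_mul, Complex.real_smul, mul_comm,
      measureReal_restrict_apply ((s n).measurableSet_fiber y)]
  have hlim : ∀ ρ (hρ : IsState ρ),
      Tendsto (fun n => I n ρ) atTop (nhds (∫ x in F, g x ∂(M.outcomeMeasure ρ hρ))) := by
    intro ρ hρ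
    simp only [hIρ _ ρ hρ]
    refine tendsto_integral_of_dominated_convergence (fun _ => c)
      (fun n => (s n).stronglyMeasurable.aestronglyMeasurable) (integrable_const c)
      (fun n => Eventually.of_forall fun x => hg.norm_approxBounded_le hc0 n x)
      (Eventually.of_forall fun x => hg.tendsto_approxBounded_of_norm_le (hc x))
  have hall : ∀ T, ∃ l, Tendsto (fun n => I n T) atTop (nhds l) := by
    intro T
    have hT : T ∈ Submodule.span ℂ {T : traceClass H | IsState T} :=
      (span_isState_eq_top (H := H)) ▸ Submodule.mem_top
    induction hT using Submodule.span_induction with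
    | mem ρ hρ => exact ⟨_, hlim ρ hρ⟩
    | zero => exact ⟨0, by simp⟩
    | add S T _ _ hS hT =>
      obtain ⟨a, ha⟩ := hS
      obtain ⟨b, hb⟩ := hT
      exact ⟨a + b, by simpa using ha.add hb⟩
    | smul z T _ hT =>
      obtain ⟨a, ha⟩ := hT
      exact ⟨z * a, by simpa using ha.const_mul z⟩
  choose l hl using hall
  refine ⟨linearMapOfTendsto l I (tendsto_pi_nhds.mpr hl), fun ρ hρ => ?_⟩
  exact tendsto_nhds_unique (hl ρ) (hlim ρ hρ)

variable {M : Instrument X H} {μ : Measure X} {D : Submodule ℂ H} {V : ℕ → X → D →ₗ[ℂ] H}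

omit [CompleteSpace H] in
theorem norm_inner_map_self_le (A : H →L[ℂ] H) {ψ : H} (hψ : ‖ψ‖ = 1) : ‖⟪ψ, A ψ⟫_ℂ‖ ≤ ‖A‖ := by
  have h1 := norm_inner_le_norm (𝕜 := ℂ) ψ (A ψ)
  have h2 := A.le_opNorm ψ
  rw [hψ] at h1 h2
  linarith

omit [CompleteSpace H] in
theorem stronglyMeasurable_inner_map_self {ψ : X → H} (hψ : StronglyMeasurable ψ)
    (A : H →L[ℂ] H) : StronglyMeasurable fun x => ⟪ψ x, A (ψ x)⟫_ℂ :=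
  hψ.inner (A.continuous.comp_stronglyMeasurable hψ)

omit [CompleteSpace H] in
theorem tsum_inner_map_of_forall_eq_smul {c : ℕ → H} {ψ : H}
    (hc : ∀ k, c k = ⟪ψ, c k⟫_ℂ • ψ) (A : H →L[ℂ] H) :
    ∑' k, ⟪c k, A (c k)⟫_ℂ = ⟪ψ, A ψ⟫_ℂ * ((∑' k, ‖⟪ψ, c k⟫_ℂ‖ ^ 2 : ℝ) : ℂ) := by
  rw [Complex.ofReal_tsum, ← tsum_mul_left]
  refine tsum_congr fun k => ?_
  conv_lhs => rw [hc k]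
  rw [map_smul, inner_smul_left, inner_smul_right, ← mul_assoc, Complex.conj_mul', mul_comm]
  push_cast; rfl

omit [InnerProductSpace ℂ H] [CompleteSpace H] in
theorem toReal_tsum_enorm_sq (c : ℕ → H) :
    (∑' k, ‖c k‖ₑ ^ 2).toReal = ∑' k, ‖c k‖ ^ 2 := by
  rw [ENNReal.tsum_toReal_eq fun _ => by finiteness]
  exact tsum_congr fun k => by simp

namespace KrausRepresentation

/-- Both sides extend to linear functionals bounded on states. They agree on vectors of $\mathcal
D$, where $\mu_\rho$ has density $\sum_k\|V_k\varphi\|^2$. -/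
theorem traceMul_op_eq_integral (hV : KrausRepresentation M μ D V) {ψ : X → H}
    (hψm : StronglyMeasurable ψ) (hψ : ∀ x, ‖ψ x‖ = 1) {F : Set X} (hF : MeasurableSet F)
    (hVF : ∀ᵐ x ∂μ.restrict F, ∀ k φ, V k x φ = ⟪ψ x, V k x φ⟫_ℂ • ψ x) {ρ : traceClass H}
    (hρ : IsState ρ) (A : H →L[ℂ] H) :
    traceMul A (M.op F ρ) = ∫ x in F, ⟪ψ x, A (ψ x)⟫_ℂ ∂(M.outcomeMeasure ρ hρ) := by
  have hb : ∀ x, ‖⟪ψ x, A (ψ x)⟫_ℂ‖ ≤ ‖A‖ := fun x => norm_inner_map_self_le A (hψ x)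
  obtain ⟨I, hI⟩ := M.exists_integral_functional hF (stronglyMeasurable_inner_map_self hψm A) hb
  have hIb : ∀ ρ, IsState ρ → ‖I ρ‖ ≤ ‖A‖ := by
    intro ρ hρ
    rw [hI ρ hρ]
    refine (norm_integral_le_of_norm_le_const (Eventually.of_forall hb)).trans ?_
    rw [measureReal_restrict_apply_univ]
    exact mul_le_of_le_one_right (norm_nonneg _) measureReal_le_one
  have hL : traceMul A ∘ₗ M.op F - I = 0 := by
    refine hV.eq_zero_of_ketBra (C := ‖A‖ + ‖A‖) (fun ρ hρ => ?_) fun φ hφ => ?_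
    · rw [LinearMap.sub_apply]
      exact (norm_sub_le _ _).trans (add_le_add (M.norm_traceMul_op_le hF A hρ) (hIb ρ hρ))
    · have hst := isState_ketBra hφ
      rw [LinearMap.sub_apply, sub_eq_zero, LinearMap.comp_apply, traceMul_apply,
        hV.trace_eq φ F hF A, hI _ hst, hV.outcomeMeasure_ketBra φ hst, restrict_withDensity hF,
        integral_withDensity_eq_integral_toReal_smul₀ (hV.aemeasurable_density φ).restrict
          (ae_restrict_of_ae (hV.density_lt_top φ))]
      refine integral_congr_ae ?_
      filter_upwards [hVF] with x hx
      rw [tsum_inner_map_of_forall_eq_smul (fun k => hx k φ) A, Complex.real_smul, mul_comm,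
        toReal_tsum_enorm_sq]
      congr 3
      funext k
      conv_rhs => rw [hx k φ, norm_smul, hψ x, mul_one]
  have := LinearMap.congr_fun hL ρ
  rw [LinearMap.sub_apply, LinearMap.zero_apply, sub_eq_zero, LinearMap.comp_apply] at this
  rw [this, hI ρ hρ]

omit [MeasurableSpace X] [CompleteSpace H] in
theorem support_eq_iUnion {k : ℕ} {f : ℕ → D} (hf : Submodule.span ℂ (Set.range f) = ⊤) :
    {x | V k x ≠ 0} = ⋃ n, {x | V k x (f n) = 0}ᶜ := by
  ext x
  simp only [Set.mem_iUnion, Set.mem_compl_iff, Set.mem_ofPred_eq]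
  constructor
  · intro h
    by_contra! h'
    exact h (LinearMap.ext_on_range hf fun n => by simpa using h' n)
  · rintro ⟨n, hn⟩ h
    exact hn (by simp [h])

theorem nullMeasurableSet_support (hV : KrausRepresentation M μ D V) (k : ℕ) :
    NullMeasurableSet {x | V k x ≠ 0} μ := by
  obtain ⟨f, hf⟩ := hV.exists_seq_span
  rw [support_eq_iUnion hf]
  exact NullMeasurableSet.iUnion fun n =>
    ((hV.aestronglyMeasurable k (f n)).nullMeasurableSet_eq_fun aestronglyMeasurable_const).compl

variable [TopologicalSpace.SeparableSpace H]

/-- Here $\psi_x$ is the normalization of the first nonzero $V_0(x)f_n$; choosing the least such $n$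
keeps it measurable. -/
theorem exists_direction (hV : KrausRepresentation M μ D V) (hirr : M.IsIrreducible) {u₀ : H}
    (hu₀ : ‖u₀‖ = 1) : ∃ ψ : X → H, StronglyMeasurable ψ ∧ (∀ x, ‖ψ x‖ = 1) ∧
      ∀ᵐ x ∂μ, V 1 x ≠ 0 → ∀ k φ, V k x φ = ⟪ψ x, V k x φ⟫_ℂ • ψ x := by
  classical
  obtain ⟨f, hf⟩ := hV.exists_seq_span
  set g : ℕ → X → H := fun n => (hV.aestronglyMeasurable 0 (f n)).mk _ with hg
  have hgm : ∀ n, StronglyMeasurable (g n) := fun n =>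
    (hV.aestronglyMeasurable 0 (f n)).stronglyMeasurable_mk
  let _ : MeasurableSpace H := borel H
  have : BorelSpace H := ⟨rfl⟩
  have h0 : ∀ n, MeasurableSet {x | g n x = 0} := fun n =>
    (hgm n).measurable (measurableSet_singleton 0)
  set G : ℕ → X → H := fun n x => if g n x = 0 then u₀ else ((‖g n x‖⁻¹ : ℝ) : ℂ) • g n x with hG
  have hGm : ∀ n, Measurable (G n) := fun n => by
    refine Measurable.ite (h0 n) measurable_const ?_
    exact (Complex.measurable_ofReal.comp (hgm n).measurable.norm.inv).smul (hgm n).measurable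
  have hG1 : ∀ n x, ‖G n x‖ = 1 := fun n x => by
    simp only [hG]
    split_ifs with h
    · exact hu₀
    · rw [norm_smul, Complex.norm_real, norm_inv, norm_norm, inv_mul_cancel₀ (norm_ne_zero_iff.mpr h)]
  -- The second alternative lets the search end when all vectors vanish; the value is then `u₀`.
  have hex : ∀ x, ∃ n, g n x ≠ 0 ∨ ∀ m, g m x = 0 := fun x => by
    by_cases h : ∀ m, g m x = 0
    · exact ⟨0, Or.inr h⟩
    · push Not at h
      exact h.imp fun _ => Or.inl
  refine ⟨fun x => G (Nat.find (hex x)) x, ?_, fun x => hG1 _ x, ?_⟩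
  · refine (Measurable.find hGm (fun n => ?_) hex).stronglyMeasurable
    have : {x | g n x ≠ 0 ∨ ∀ m, g m x = 0} = {x | g n x = 0}ᶜ ∪ ⋂ m, {x | g m x = 0} := by
      ext x; simp
    rw [this]
    exact (h0 n).compl.union (MeasurableSet.iInter h0)
  · have hmk : ∀ᵐ x ∂μ, ∀ n, V 0 x (f n) = g n x :=
      ae_all_iff.mpr fun n => (hV.aestronglyMeasurable 0 (f n)).ae_eq_mk
    filter_upwards [hmk, hV.zero_of_le, hV.ae_exists_smul_zero hirr] with x hmk hle hd h1
    have h00 : V 0 x ≠ 0 := fun h => h1 (hle 0 1 (by simp) h)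
    have hn : g (Nat.find (hex x)) x ≠ 0 := by
      refine (Nat.find_spec (hex x)).resolve_right fun h => h00 ?_
      exact LinearMap.ext_on_range hf fun n => by rw [hmk, h]; rfl
    set n := Nat.find (hex x)
    have hψ := hG1 n x
    intro k φ
    obtain ⟨z, hz⟩ := hd h1 (f n) (by rwa [hmk]) k φ
    have hzψ : V k x φ = (z * (‖g n x‖ : ℂ)) • G n x := by
      have hne : (‖g n x‖ : ℂ) ≠ 0 := by exact_mod_cast norm_ne_zero_iff.mpr hn
      simp only [hG, if_neg hn]
      rw [smul_smul, mul_assoc, Complex.ofReal_inv, mul_inv_cancel₀ hne, mul_one, hz, hmk]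
    have hi : ⟪G n x, G n x⟫_ℂ = 1 := by rw [inner_self_eq_norm_sq_to_K, hψ]; simp
    rw [hzψ, inner_smul_right, hi, mul_one]

/-- For each $A$ the two integrands have equal integrals over all measurable parts of $F_s$, so they
agree almost everywhere. Rank-one operators built from a dense sequence determine the operator and
need only countably many null sets. -/
theorem ae_eq_ketBra (hV : KrausRepresentation M μ D V) {ψ : X → H}
    (hψm : StronglyMeasurable ψ) (hψ : ∀ x, ‖ψ x‖ = 1)
    (hVψ : ∀ᵐ x ∂μ, V 1 x ≠ 0 → ∀ k φ, V k x φ = ⟪ψ x, V k x φ⟫_ℂ • ψ x) {ρ : traceClass H}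
    (hρ : IsState ρ) {r : X → traceClass H} (hr : M.IsPosteriorFamily ρ hρ r) :
    ∀ᵐ x ∂(M.outcomeMeasure ρ hρ), V 1 x ≠ 0 → r x = ketBra (ψ x) (ψ x) := by
  -- $F_s$ is only null-measurable; `t` is a measurable subset of it of full measure.
  obtain ⟨t, htF, htm, hte⟩ := (hV.nullMeasurableSet_support 1).exists_measurable_subset_ae_eq
  have hint : ∀ A : H →L[ℂ] H, ∀ᵐ x ∂(M.outcomeMeasure ρ hρ).restrict t,
      traceMul A (r x) = ⟪ψ x, A (ψ x)⟫_ℂ := by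
    intro A
    refine Integrable.ae_eq_of_forall_setIntegral_eq _ _ ?_ ?_ fun s hs _ => ?_
    · refine Integrable.restrict ?_
      refine Integrable.mono' (integrable_const ‖A‖) (hr.aemeasurable A).aestronglyMeasurable ?_
      filter_upwards [hr.isState] with x hx
      have := hx.isPos.norm_traceMul_le A
      rwa [hx.trace_eq_one, Complex.one_re, mul_one] at this
    · refine Integrable.restrict ?_
      exact Integrable.mono' (integrable_const ‖A‖)
        (stronglyMeasurable_inner_map_self hψm A).aestronglyMeasurable
        (Eventually.of_forall fun x => norm_inner_map_self_le A (hψ x))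
    · rw [Measure.restrict_restrict hs]
      have hm := hs.inter htm
      refine (hr.integral_eq _ hm A).trans ?_
      refine hV.traceMul_op_eq_integral hψm hψ hm ?_ hρ A
      rw [ae_restrict_iff' hm]
      filter_upwards [hVψ] with x hx hxt
      exact hx (htF hxt.2)
  have hall := ae_all_iff.mpr fun n => ae_all_iff.mpr fun m =>
    hint (InnerProductSpace.rankOne ℂ (TopologicalSpace.denseSeq H n)
      (TopologicalSpace.denseSeq H m))
  have h1 : ∀ᵐ x ∂(M.outcomeMeasure ρ hρ).restrict t, r x = ketBra (ψ x) (ψ x) := by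
    filter_upwards [hall] with x hx
    have hd := TopologicalSpace.denseRange_denseSeq H
    refine Subtype.ext (ContinuousLinearMap.coeFn_injective ?_)
    refine hd.equalizer (ContinuousLinearMap.continuous _) (ContinuousLinearMap.continuous _) ?_
    funext n
    refine ext_inner_right ℂ fun v => ?_
    suffices h : (fun v => ⟪(r x : H →L[ℂ] H) (TopologicalSpace.denseSeq H n), v⟫_ℂ) =
        fun v => ⟪(ketBra (ψ x) (ψ x) : H →L[ℂ] H) (TopologicalSpace.denseSeq H n), v⟫_ℂ from
      congrFun h v
    refine hd.equalizer (by fun_prop) (by fun_prop) (funext fun m => ?_)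
    have h := hx n m
    rw [traceMul_rankOne, InnerProductSpace.rankOne_apply, inner_smul_right] at h
    simp only [Function.comp_apply]
    rw [← inner_conj_symm, h, ketBra_apply, inner_smul_left, map_mul, inner_conj_symm,
      inner_conj_symm, mul_comm]
  rw [ae_restrict_iff' htm] at h1
  have h2 := (hV.outcomeMeasure_absolutelyContinuous hρ).ae_le hte
  filter_upwards [h1, h2] with x hx h2 hx1
  exact hx (h2.mpr hx1)

end KrausRepresentation
end PosteriorDirection
-- The multiplication spectral measure on $L^2(\mu)$
section MultiplicationMeasure

variable {X : Type v} [MeasurableSpace X] (μ : Measure X)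

open Classical in
/-- Multiplication by the indicator function of a measurable set on `L²(μ)`. -/
noncomputable def indicatorL2 (F : Set X) : Lp ℂ 2 μ →L[ℂ] Lp ℂ 2 μ :=
  if hF : MeasurableSet F then
    LinearMap.mkContinuous
      { toFun := fun f => ((Lp.memLp f).indicator hF).toLp
        map_add' := fun f g => by
          rw [← MemLp.toLp_add]
          refine MemLp.toLp_congr _ _ ?_
          filter_upwards [Lp.coeFn_add f g] with x hx
          by_cases h : x ∈ F
          · simp only [Set.indicator_of_mem h, Pi.add_apply, hx]
          · simp only [Set.indicator_of_notMem h, Pi.add_apply, add_zero]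
        map_smul' := fun z f => by
          rw [RingHom.id_apply, ← MemLp.toLp_const_smul]
          refine MemLp.toLp_congr _ _ ?_
          filter_upwards [Lp.coeFn_smul z f] with x hx
          by_cases h : x ∈ F <;> simp [h, hx] }
      1 fun f => by
        rw [one_mul, LinearMap.coe_mk, AddHom.coe_mk, Lp.norm_toLp, Lp.norm_def]
        exact ENNReal.toReal_mono (Lp.memLp f).eLpNorm_ne_top (eLpNorm_indicator_le _)
  else 0

variable {μ}

theorem coeFn_indicatorL2 {F : Set X} (hF : MeasurableSet F) (f : Lp ℂ 2 μ) :
    indicatorL2 μ F f =ᵐ[μ] F.indicator f := by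
  rw [indicatorL2, dif_pos hF]
  exact ((Lp.memLp f).indicator hF).coeFn_toLp

theorem inner_indicatorL2 {F : Set X} (hF : MeasurableSet F) (f g : Lp ℂ 2 μ) :
    ⟪f, indicatorL2 μ F g⟫_ℂ = ∫ x in F, ⟪f x, g x⟫_ℂ ∂μ := by
  rw [L2.inner_def, ← integral_indicator hF]
  refine integral_congr_ae ?_
  filter_upwards [coeFn_indicatorL2 hF g] with x hx
  rw [hx]
  by_cases h : x ∈ F <;> simp [h]

theorem indicatorL2_indicatorL2 {E F : Set X} (hE : MeasurableSet E) (hF : MeasurableSet F)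
    (f : Lp ℂ 2 μ) : indicatorL2 μ E (indicatorL2 μ F f) = indicatorL2 μ (E ∩ F) f := by
  refine Lp.ext ?_
  filter_upwards [coeFn_indicatorL2 hE (indicatorL2 μ F f), coeFn_indicatorL2 hF f,
    coeFn_indicatorL2 (hE.inter hF) f] with x h1 h2 h3
  rw [h1, h3, ← Set.indicator_indicator]
  by_cases h : x ∈ E <;> simp [h, h2]

theorem indicatorL2_isSymmetric {F : Set X} (hF : MeasurableSet F) (f g : Lp ℂ 2 μ) :
    ⟪indicatorL2 μ F f, g⟫_ℂ = ⟪f, indicatorL2 μ F g⟫_ℂ := by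
  rw [← inner_conj_symm, inner_indicatorL2 hF, inner_indicatorL2 hF, ← integral_conj]
  simp only [inner_conj_symm]

theorem inner_indicatorL2_indicatorL2 {E F : Set X} (hE : MeasurableSet E) (hF : MeasurableSet F)
    (f g : Lp ℂ 2 μ) : ⟪indicatorL2 μ E f, indicatorL2 μ F g⟫_ℂ =
      ∫ x in E ∩ F, ⟪f x, g x⟫_ℂ ∂μ := by
  rw [indicatorL2_isSymmetric hE, indicatorL2_indicatorL2 hE hF, inner_indicatorL2 (hE.inter hF)]

/-- By Pythagoras $\|\sum_{i\in s}w_i-v\|^2=\|v\|^2-\sum_{i\in s}\|w_i\|^2$. Strong σ-additivity of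
the spectral measure thus reduces to that of a scalar integral. -/
theorem hasSum_of_inner_eq {E ι : Type*} [NormedAddCommGroup E] [InnerProductSpace ℂ E]
    {w : ι → E} {v : E} (horth : Pairwise fun i j => ⟪w i, w j⟫_ℂ = 0)
    (hv : ∀ i, ⟪v, w i⟫_ℂ = ⟪w i, w i⟫_ℂ) (hs : HasSum (fun i => ⟪w i, w i⟫_ℂ) ⟪v, v⟫_ℂ) :
    HasSum w v := by
  have key : ∀ s : Finset ι, ⟪(∑ i ∈ s, w i) - v, (∑ i ∈ s, w i) - v⟫_ℂ =
      ⟪v, v⟫_ℂ - ∑ i ∈ s, ⟪w i, w i⟫_ℂ := by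
    intro s
    have h1 : ⟪v, ∑ i ∈ s, w i⟫_ℂ = ∑ i ∈ s, ⟪w i, w i⟫_ℂ := by
      rw [inner_sum]; exact Finset.sum_congr rfl fun i _ => hv i
    have h2 : ⟪∑ i ∈ s, w i, v⟫_ℂ = ∑ i ∈ s, ⟪w i, w i⟫_ℂ := by
      rw [sum_inner]
      refine Finset.sum_congr rfl fun i _ => ?_
      rw [← inner_conj_symm, hv, inner_conj_symm]
    have h3 : ⟪∑ i ∈ s, w i, ∑ i ∈ s, w i⟫_ℂ = ∑ i ∈ s, ⟪w i, w i⟫_ℂ := by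
      rw [sum_inner]
      refine Finset.sum_congr rfl fun i hi => ?_
      rw [inner_sum, Finset.sum_eq_single i (fun j _ hji => horth hji.symm)
        (fun h => absurd hi h)]
    rw [inner_sub_left, inner_sub_right, inner_sub_right, h1, h2, h3]; ring
  have hlim : Tendsto (fun s : Finset ι => ‖(∑ i ∈ s, w i) - v‖ ^ 2) atTop (nhds 0) := by
    have h := (Complex.continuous_re.tendsto _).comp (Tendsto.const_sub ⟪v, v⟫_ℂ hs)
    rw [sub_self, Complex.zero_re] at h
    refine h.congr fun s => ?_
    rw [Function.comp_apply, ← key s]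
    exact inner_self_eq_norm_sq (𝕜 := ℂ) _
  refine tendsto_iff_norm_sub_tendsto_zero.mpr ?_
  have h := hlim.sqrt
  simpa using h

variable (μ)

/-- The spectral measure on `L²(μ)` given by multiplication with indicator functions. -/
noncomputable def multiplicationMeasure : SpectralMeasure X (Lp ℂ 2 μ) where
  proj := indicatorL2 μ
  isStarProjection F hF := by
    refine ⟨?_, ?_⟩
    · refine ContinuousLinearMap.ext fun f => ?_
      rw [mul_apply_eq_comp, indicatorL2_indicatorL2 hF hF, Set.inter_self]
    · rw [ContinuousLinearMap.isSelfAdjoint_iff_isSymmetric]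
      exact indicatorL2_isSymmetric hF
  univ_eq := by
    refine ContinuousLinearMap.ext fun f => Lp.ext ?_
    filter_upwards [coeFn_indicatorL2 MeasurableSet.univ f] with x hx
    rw [hx, Set.indicator_univ, ContinuousLinearMap.id_apply]
  sigmaAdditive F hF hd f := by
    have hU := MeasurableSet.iUnion hF
    refine hasSum_of_inner_eq (fun i j hij => ?_) (fun i => ?_) ?_
    · beta_reduce
      rw [inner_indicatorL2_indicatorL2 (hF i) (hF j), (hd hij).inter_eq]; simp
    · rw [inner_indicatorL2_indicatorL2 hU (hF i), inner_indicatorL2_indicatorL2 (hF i) (hF i),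
        Set.inter_self, Set.inter_eq_right.mpr (Set.subset_iUnion F i)]
    · simp only [inner_indicatorL2_indicatorL2 (hF _) (hF _), Set.inter_self,
        inner_indicatorL2_indicatorL2 hU hU]
      exact hasSum_integral_iUnion hF hd (L2.integrable_inner f f).integrableOn

/-- By σ-finiteness there is an integrable $g>0$, and $\sqrt g$ is cyclic: if $f$ is orthogonal to
every $1_s\sqrt g$, then $\bar f\sqrt g=0$ almost everywhere. -/
theorem multiplicationMeasure_hasMultiplicityOne [SigmaFinite μ] :
    (multiplicationMeasure μ).HasMultiplicityOne := by
  obtain ⟨g, hg0, hgm, hg⟩ := exists_pos_lintegral_lt_of_sigmaFinite μ one_ne_zero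
  set h : X → ℂ := fun x => ((√(g x : ℝ) : ℝ) : ℂ) with hh
  have hm : Measurable h := Complex.measurable_ofReal.comp hgm.coe_nnreal_real.sqrt
  have hL : MemLp h 2 μ := by
    rw [memLp_two_iff_integrable_sq_norm hm.aestronglyMeasurable]
    refine ⟨(hm.norm.pow_const 2).aestronglyMeasurable, ?_⟩
    refine lt_of_le_of_lt (le_of_eq (lintegral_congr fun x => ?_)) (hg.trans ENNReal.one_lt_top)
    simp [hh]
  refine ⟨hL.toLp, ?_⟩
  rw [Submodule.topologicalClosure_eq_top_iff, eq_bot_iff]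
  intro f hf
  have h0 : (fun x => ⟪f x, hL.toLp h x⟫_ℂ) =ᵐ[μ] 0 := by
    refine ae_eq_zero_of_forall_setIntegral_eq_of_sigmaFinite
      (fun s _ _ => (L2.integrable_inner f (hL.toLp h)).integrableOn) fun s hs _ => ?_
    rw [← inner_indicatorL2 hs]
    have hmem : indicatorL2 μ s (hL.toLp h) ∈ Submodule.span ℂ
        {w | ∃ F, MeasurableSet F ∧ w = (multiplicationMeasure μ).proj F (hL.toLp h)} :=
      Submodule.subset_span ⟨s, hs, rfl⟩
    exact Submodule.inner_left_of_mem_orthogonal hmem hf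
  refine (Submodule.mem_bot ℂ).mpr (Lp.ext ?_)
  filter_upwards [h0, hL.coeFn_toLp, Lp.coeFn_zero ℂ 2 μ] with x h0 h1 h2
  have hne : h x ≠ 0 := by
    simpa [hh, Real.sqrt_eq_zero'] using (hg0 x).ne'
  rw [h1, Pi.zero_apply, RCLike.inner_apply', mul_eq_zero] at h0
  rw [h2, Pi.zero_apply]
  simpa using h0.resolve_right hne

end MultiplicationMeasure

/-! ### Embedding $L^2(\mu;\mathcal H)$ into $\mathcal H\otimes L^2(\mu)$ -/

section TensorEmbedding

theorem orthonormal_countable {E ι : Type*} [NormedAddCommGroup E] [InnerProductSpace ℂ E]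
    [TopologicalSpace.SeparableSpace E] {e : ι → E} (he : Orthonormal ℂ e) : Countable ι := by
  refine Pairwise.countable_of_isOpen_disjoint (s := fun i => Metric.ball (e i) (1 / 2))
    (fun i j hij => Metric.ball_disjoint_ball ?_) (fun i => Metric.isOpen_ball)
    fun i => ⟨e i, Metric.mem_ball_self (by norm_num)⟩
  rw [dist_eq_norm]
  have h : ‖e i - e j‖ ^ 2 = 2 := by
    rw [norm_sub_sq (𝕜 := ℂ), he.1 i, he.1 j, he.2 hij]; norm_num
  nlinarith [norm_nonneg (e i - e j)]

variable {X : Type v} [MeasurableSpace X] {μ : Measure X} {H : Type u} [NormedAddCommGroup H]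
  [InnerProductSpace ℂ H]

theorem norm_sq_eq_integral (f : Lp H 2 μ) : ‖f‖ ^ 2 = ∫ x, ‖f x‖ ^ 2 ∂μ := by
  have h := congrArg Complex.re (L2.inner_def (𝕜 := ℂ) f f)
  rw [show (⟪f, f⟫_ℂ).re = ‖f‖ ^ 2 from inner_self_eq_norm_sq (𝕜 := ℂ) f] at h
  rw [h]
  have : ∀ x, ⟪f x, f x⟫_ℂ = ((‖f x‖ ^ 2 : ℝ) : ℂ) := fun x => by
    rw [inner_self_eq_norm_sq_to_K]; simp
  simp only [this, integral_complex_ofReal, Complex.ofReal_re]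

omit [InnerProductSpace ℂ H] in
theorem integrable_norm_sq (f : Lp H 2 μ) : Integrable (fun x => ‖f x‖ ^ 2) μ :=
  (memLp_two_iff_integrable_sq_norm (Lp.memLp f).1).mp (Lp.memLp f)

/-- The elementary tensor `φ ⊗ χ` in the Hilbert space tensor product. -/
noncomputable def tmulCompl {K : Type v} [NormedAddCommGroup K] [InnerProductSpace ℂ K] (φ : H) :
    K →ₗ[ℂ] HilbertTensor H K :=
  (UniformSpace.Completion.toComplₗᵢ (𝕜 := ℂ) (E := H ⊗[ℂ] K)).toLinearMap ∘ₗ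
    TensorProduct.mk ℂ H K φ

theorem tmulCompl_apply {K : Type v} [NormedAddCommGroup K] [InnerProductSpace ℂ K] (φ : H)
    (χ : K) : tmulCompl φ χ = ((φ ⊗ₜ[ℂ] χ : H ⊗[ℂ] K) : HilbertTensor H K) := rfl

theorem inner_tmulCompl {K : Type v} [NormedAddCommGroup K] [InnerProductSpace ℂ K] (φ φ' : H)
    (χ χ' : K) : ⟪tmulCompl φ χ, tmulCompl φ' χ'⟫_ℂ = ⟪φ, φ'⟫_ℂ * ⟪χ, χ'⟫_ℂ := by
  rw [tmulCompl_apply, tmulCompl_apply, UniformSpace.Completion.inner_coe,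
    TensorProduct.inner_tmul]

theorem tensorOp_tmulCompl {K : Type v} [NormedAddCommGroup K] [InnerProductSpace ℂ K]
    (A : H →L[ℂ] H) (B : K →L[ℂ] K) (φ : H) (χ : K) :
    tensorOp A B (tmulCompl φ χ) = tmulCompl (A φ) (B χ) := by
  rw [tmulCompl_apply, tmulCompl_apply, tensorOp, ContinuousLinearMap.completion_apply_coe]
  rfl

variable {ι : Type*} (e : HilbertBasis ι ℂ H)

/-- The coordinate `⟨e i, f(·)⟩ ∈ L²(μ)` of `f ∈ L²(μ; H)`. -/
noncomputable def coordL2 (i : ι) : Lp H 2 μ →L[ℂ] Lp ℂ 2 μ :=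
  (innerSL ℂ (e i)).compLpL 2 μ

theorem coeFn_coordL2 (i : ι) (f : Lp H 2 μ) :
    coordL2 e i f =ᵐ[μ] fun x => ⟪e i, f x⟫_ℂ :=
  (innerSL ℂ (e i)).coeFn_compLpL f

/-- The summands are orthogonal, so square-summable norms suffice; these come from integrating
Bessel's inequality. -/
theorem summable_tmulCompl_coordL2 (f : Lp H 2 μ) :
    Summable fun i => tmulCompl (e i) (coordL2 e i f) := by
  have hb : ∀ s : Finset ι, ∑ i ∈ s, ‖coordL2 e i f‖ ^ 2 ≤ ‖f‖ ^ 2 := by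
    intro s
    simp only [norm_sq_eq_integral]
    rw [← integral_finsetSum s fun i _ => integrable_norm_sq _]
    refine integral_mono_ae (integrable_finsetSum s fun i _ => integrable_norm_sq _)
      (integrable_norm_sq f) ?_
    have hc : ∀ᵐ x ∂μ, ∀ i ∈ s, coordL2 e i f x = ⟪e i, f x⟫_ℂ :=
      (Filter.eventually_all_finset s).mpr fun i _ => coeFn_coordL2 e i f
    filter_upwards [hc] with x hx
    rw [Finset.sum_congr rfl fun i hi => by rw [hx i hi]]
    exact e.orthonormal.sum_inner_products_le (f x)
  have hs : Summable fun i => ‖coordL2 e i f‖ ^ 2 :=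
    summable_of_sum_le (fun i => by positivity) hb
  let W : ι → Lp ℂ 2 μ →ₗᵢ[ℂ] HilbertTensor H (Lp ℂ 2 μ) := fun i =>
    LinearMap.isometryOfInner (tmulCompl (e i)) fun χ χ' => by
      rw [inner_tmulCompl, inner_self_eq_norm_sq_to_K, e.orthonormal.1 i]; simp
  have hW : OrthogonalFamily ℂ (fun _ : ι => Lp ℂ 2 μ) W := fun i j hij χ χ' => by
    change ⟪tmulCompl (e i) χ, tmulCompl (e j) χ'⟫_ℂ = 0
    rw [inner_tmulCompl, e.orthonormal.2 hij, zero_mul]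
  exact (hW.summable_iff_norm_sq_summable fun i => coordL2 e i f).mpr hs

theorem integrable_inner_map_coord (A : H →L[ℂ] H) (f : Lp H 2 μ) (i j : ι) :
    Integrable (fun x => ⟪⟪e i, f x⟫_ℂ • e i, A (⟪e j, f x⟫_ℂ • e j)⟫_ℂ) μ := by
  have h := (L2.integrable_inner (𝕜 := ℂ) (coordL2 e i f) (coordL2 e j f)).mul_const
    ⟪e i, A (e j)⟫_ℂ
  refine h.congr ?_
  filter_upwards [coeFn_coordL2 e i f, coeFn_coordL2 e j f] with x h1 h2
  rw [h1, h2, map_smul, inner_smul_left, inner_smul_right, RCLike.inner_apply']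
  ring

theorem inner_sum_tensorOp_sum (A : H →L[ℂ] H) {F : Set X} (hF : MeasurableSet F) (f : Lp H 2 μ)
    (s : Finset ι) : ⟪∑ i ∈ s, tmulCompl (e i) (coordL2 e i f),
      tensorOp A (indicatorL2 μ F) (∑ i ∈ s, tmulCompl (e i) (coordL2 e i f))⟫_ℂ =
      ∫ x in F, ⟪∑ i ∈ s, ⟪e i, f x⟫_ℂ • e i, A (∑ i ∈ s, ⟪e i, f x⟫_ℂ • e i)⟫_ℂ ∂μ := by
  simp only [map_sum, sum_inner, inner_sum, tensorOp_tmulCompl, inner_tmulCompl]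
  rw [integral_finsetSum s fun j _ => integrable_finsetSum s fun i _ =>
    (integrable_inner_map_coord e A f i j).integrableOn]
  refine Finset.sum_congr rfl fun j _ => ?_
  rw [integral_finsetSum s fun i _ => (integrable_inner_map_coord e A f i j).integrableOn]
  refine Finset.sum_congr rfl fun i _ => ?_
  rw [inner_indicatorL2 hF, ← integral_const_mul]
  refine integral_congr_ae (ae_restrict_of_ae ?_)
  filter_upwards [coeFn_coordL2 e i f, coeFn_coordL2 e j f] with x h1 h2
  rw [h1, h2, map_smul, inner_smul_left, inner_smul_right, RCLike.inner_apply']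
  ring

theorem norm_inner_map_le (A : H →L[ℂ] H) (y : H) : ‖⟪y, A y⟫_ℂ‖ ≤ ‖A‖ * ‖y‖ ^ 2 :=
  calc ‖⟪y, A y⟫_ℂ‖ ≤ ‖y‖ * ‖A y‖ := norm_inner_le_norm _ _
    _ ≤ ‖y‖ * (‖A‖ * ‖y‖) := by gcongr; exact A.le_opNorm _
    _ = ‖A‖ * ‖y‖ ^ 2 := by ring

theorem norm_sq_sum_inner_smul_le (s : Finset ι) (y : H) :
    ‖∑ i ∈ s, ⟪e i, y⟫_ℂ • e i‖ ^ 2 ≤ ‖y‖ ^ 2 := by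
  refine le_trans (le_of_eq ?_) (e.orthonormal.sum_inner_products_le y (s := s))
  rw [← inner_self_eq_norm_sq (𝕜 := ℂ), e.orthonormal.inner_sum, map_sum]
  refine Finset.sum_congr rfl fun i _ => ?_
  rw [RCLike.conj_mul]
  simp [← Complex.ofReal_pow]

/-- Limit of the finite identity, dominated by $\|A\|\|f(x)\|^2$. A countable basis is what makes
dominated convergence available along finite subsets. -/
theorem inner_tsum_tensorOp_tsum [Countable ι] (A : H →L[ℂ] H) {F : Set X} (hF : MeasurableSet F)
    (f : Lp H 2 μ) : ⟪∑' i, tmulCompl (e i) (coordL2 e i f),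
      tensorOp A (indicatorL2 μ F) (∑' i, tmulCompl (e i) (coordL2 e i f))⟫_ℂ =
      ∫ x in F, ⟪f x, A (f x)⟫_ℂ ∂μ := by
  have hs := (summable_tmulCompl_coordL2 e f).hasSum
  have h1 := Tendsto.inner (𝕜 := ℂ) hs
    (((tensorOp A (indicatorL2 μ F)).continuous.tendsto _).comp hs)
  simp only [Function.comp_def, inner_sum_tensorOp_sum e A hF] at h1
  refine tendsto_nhds_unique h1 ?_
  have hm : ∀ s : Finset ι, AEStronglyMeasurable (fun x => ∑ i ∈ s, ⟪e i, f x⟫_ℂ • e i) μ :=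
    fun s => Finset.aestronglyMeasurable_fun_sum s fun i _ =>
      (aestronglyMeasurable_const.inner (Lp.memLp f).1).smul aestronglyMeasurable_const
  refine tendsto_integral_filter_of_dominated_convergence (fun x => ‖A‖ * ‖f x‖ ^ 2)
    (Eventually.of_forall fun s => ?_) (Eventually.of_forall fun s => ?_)
    ((integrable_norm_sq f).const_mul _).integrableOn ?_
  · exact ((hm s).inner (A.continuous.comp_aestronglyMeasurable (hm s))).restrict
  · refine Eventually.of_forall fun x => (norm_inner_map_le A _).trans ?_
    gcongr ‖A‖ * ?_
    exact norm_sq_sum_inner_smul_le e s (f x)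
  · refine Eventually.of_forall fun x => ?_
    have h := e.hasSum_repr (f x)
    simp only [HilbertBasis.repr_apply_apply] at h
    exact Tendsto.inner h ((A.continuous.tendsto _).comp h)

theorem tensorOp_id {K : Type v} [NormedAddCommGroup K] [InnerProductSpace ℂ K] :
    tensorOp (ContinuousLinearMap.id ℂ H) (ContinuousLinearMap.id ℂ K) =
      ContinuousLinearMap.id ℂ (HilbertTensor H K) := by
  refine ContinuousLinearMap.ext fun ξ => ?_
  refine UniformSpace.Completion.induction_on ξ
    (isClosed_eq (ContinuousLinearMap.continuous _) (ContinuousLinearMap.continuous _)) fun a => ?_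
  rw [tensorOp, ContinuousLinearMap.completion_apply_coe, ContinuousLinearMap.id_apply,
    TensorProduct.mapL_id_id, ContinuousLinearMap.id_apply]

/-- The map is $f\mapsto\sum_i e_i\otimes\langle e_i,f\rangle$; that it is isometric is the case
$A=1$, $F=X$ of the integral formula. -/
theorem exists_tensor_embedding (μ : Measure X) [CompleteSpace H]
    [TopologicalSpace.SeparableSpace H] :
    ∃ J : Lp H 2 μ →ₗᵢ[ℂ] HilbertTensor H (Lp ℂ 2 μ), ∀ (A : H →L[ℂ] H) (F : Set X),
      MeasurableSet F → ∀ f : Lp H 2 μ, ⟪J f, tensorOp A (indicatorL2 μ F) (J f)⟫_ℂ =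
        ∫ x in F, ⟪f x, A (f x)⟫_ℂ ∂μ := by
  obtain ⟨w, e, -⟩ := exists_hilbertBasis ℂ H
  have : Countable w := orthonormal_countable e.orthonormal
  let J : Lp H 2 μ →ₗ[ℂ] HilbertTensor H (Lp ℂ 2 μ) :=
    { toFun := fun f => ∑' i, tmulCompl (e i) (coordL2 e i f)
      map_add' := fun f g => by
        simp only [map_add]
        exact (summable_tmulCompl_coordL2 e f).tsum_add (summable_tmulCompl_coordL2 e g)
      map_smul' := fun z f => by
        simp only [map_smul, RingHom.id_apply]
        exact (summable_tmulCompl_coordL2 e f).tsum_const_smul z }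
  refine ⟨⟨J, fun f => ?_⟩, fun A F hF f => inner_tsum_tensorOp_tsum e A hF f⟩
  have h := inner_tsum_tensorOp_tsum e (ContinuousLinearMap.id ℂ H) MeasurableSet.univ f
  rw [show indicatorL2 μ Set.univ = ContinuousLinearMap.id ℂ _ from
    (multiplicationMeasure μ).univ_eq, tensorOp_id, Measure.restrict_univ] at h
  simp only [ContinuousLinearMap.id_apply] at h
  rw [← L2.inner_def] at h
  have h' := congrArg Complex.re h
  have h2 : ‖J f‖ ^ 2 = ‖f‖ ^ 2 :=
    (inner_self_eq_norm_sq (𝕜 := ℂ) _).symm.trans (h'.trans (inner_self_eq_norm_sq (𝕜 := ℂ) f))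
  exact (pow_left_inj₀ (norm_nonneg _) (norm_nonneg _) two_ne_zero).mp h2

end TensorEmbedding
-- Efficiency when a single operator remains
section Efficiency

variable {X : Type v} [MeasurableSpace X] {H : Type u} [NormedAddCommGroup H]
  [InnerProductSpace ℂ H] [CompleteSpace H] {M : Instrument X H} {μ : Measure X}
  {D : Submodule ℂ H} {V : ℕ → X → D →ₗ[ℂ] H}

omit [InnerProductSpace ℂ H] [CompleteSpace H] in
theorem lintegral_enorm_sq_eq (f : X → H) : ∫⁻ x, ‖f x‖ₑ ^ 2 ∂μ = eLpNorm f 2 μ ^ 2 := by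
  have h := eLpNorm_nnreal_pow_eq_lintegral (μ := μ) (f := f) (p := 2) two_ne_zero
  simpa using h.symm

namespace KrausRepresentation

/-- Trace preservation says $\int\|V_0(x)\varphi\|^2\,\mu(dx)=\|\varphi\|^2$. So although each
$V_0(x)$ may be unbounded, $\varphi\mapsto V_0(\cdot)\varphi$ extends to an isometry of $\mathcal
H$. -/
theorem isEfficient_of_ae_eq_zero [SigmaFinite μ] [TopologicalSpace.SeparableSpace H]
    (hV : KrausRepresentation M μ D V) (h1 : ∀ᵐ x ∂μ, V 1 x = 0) : M.IsEfficient := by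
  have hz : ∀ᵐ x ∂μ, ∀ k, k ≠ 0 → V k x = 0 := by
    filter_upwards [h1, hV.zero_of_le] with x hx hle k hk
    exact hle 1 k (Nat.one_le_iff_ne_zero.mpr hk) hx
  have hnorm : ∀ φ : D, eLpNorm (fun x => V 0 x φ) 2 μ = ‖(φ : H)‖ₑ := by
    intro φ
    have h : eLpNorm (fun x => V 0 x φ) 2 μ ^ 2 = ‖(φ : H)‖ₑ ^ 2 := by
      rw [← lintegral_enorm_sq_eq, ← hV.lintegral_density φ]
      refine lintegral_congr_ae ?_
      filter_upwards [hz] with x hx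
      exact (tsum_eq_single (f := fun k => ‖V k x φ‖ₑ ^ 2) 0 fun k hk => by simp [hx k hk]).symm
    exact (ENNReal.pow_right_strictMono two_ne_zero).injective h
  have hLp : ∀ φ : D, MemLp (fun x => V 0 x φ) 2 μ := fun φ =>
    ⟨hV.aestronglyMeasurable 0 φ, by rw [hnorm φ]; exact enorm_lt_top⟩
  let W : D →ₗ[ℂ] Lp H 2 μ :=
    { toFun := fun φ => (hLp φ).toLp
      map_add' := fun φ χ => by
        rw [← MemLp.toLp_add]
        exact MemLp.toLp_congr _ _ (Eventually.of_forall fun x => map_add (V 0 x) φ χ)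
      map_smul' := fun z φ => by
        rw [RingHom.id_apply, ← MemLp.toLp_const_smul]
        exact MemLp.toLp_congr _ _ (Eventually.of_forall fun x => map_smul (V 0 x) z φ) }
  have hW : ∀ φ : D, ‖W φ‖ = ‖(φ : H)‖ := fun φ => by
    change ‖(hLp φ).toLp‖ = _
    rw [Lp.norm_toLp, hnorm φ, toReal_enorm]
  have hdense : DenseRange D.subtype := by
    rw [DenseRange, D.coe_subtype, Subtype.range_coe]; exact hV.dense
  have hbd : ∃ C, ∀ φ, ‖W φ‖ ≤ C * ‖D.subtype φ‖ := ⟨1, fun φ => by rw [hW, one_mul]; rfl⟩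
  let W' : H →ₗᵢ[ℂ] Lp H 2 μ :=
    { toLinearMap := (W.extendOfNorm D.subtype).toLinearMap
      norm_map' := fun y => by
        refine hdense.induction_on (p := fun y => ‖W.extendOfNorm D.subtype y‖ = ‖y‖) y
          (isClosed_eq (by fun_prop) (by fun_prop)) fun φ => ?_
        rw [LinearMap.extendOfNorm_eq hdense hbd, hW]; rfl }
  have hW' : ∀ φ : D, W' φ = W φ := fun φ => LinearMap.extendOfNorm_eq hdense hbd φ
  obtain ⟨J, hJ⟩ := exists_tensor_embedding (H := H) μ
  refine ⟨Lp ℂ 2 μ, inferInstance, inferInstance, inferInstance, multiplicationMeasure μ,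
    J.comp W', multiplicationMeasure_hasMultiplicityOne μ, fun F hF A T => ?_⟩
  set B := ContinuousLinearMap.adjoint (J.comp W').toContinuousLinearMap ∘L
    tensorOp A ((multiplicationMeasure μ).proj F) ∘L (J.comp W').toContinuousLinearMap with hB
  have hL : traceMul A ∘ₗ M.op F - traceMul B = 0 := by
    refine hV.eq_zero_of_ketBra (C := ‖A‖ + ‖B‖) (fun ρ hρ => ?_) fun φ hφ => ?_
    · rw [LinearMap.sub_apply]
      refine (norm_sub_le _ _).trans (add_le_add (M.norm_traceMul_op_le hF A hρ) ?_)
      have := hρ.isPos.norm_traceMul_le B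
      rwa [hρ.trace_eq_one, Complex.one_re, mul_one] at this
    · rw [LinearMap.sub_apply, sub_eq_zero, LinearMap.comp_apply, traceMul_apply,
        hV.trace_eq φ F hF A, traceMul_ketBra, hB, ContinuousLinearMap.comp_apply,
        ContinuousLinearMap.adjoint_inner_right, ContinuousLinearMap.comp_apply]
      have h := hJ A F hF (W' φ)
      refine Eq.trans ?_ h.symm
      refine integral_congr_ae (ae_restrict_of_ae ?_)
      rw [hW']
      filter_upwards [hz, (hLp φ).coeFn_toLp] with x hx hφx
      change _ = ⟪(hLp φ).toLp _ x, A ((hLp φ).toLp _ x)⟫_ℂ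
      rw [hφx]
      exact tsum_eq_single 0 fun k hk => by simp [hx k hk]
  have := LinearMap.congr_fun hL T
  rw [LinearMap.sub_apply, LinearMap.zero_apply, sub_eq_zero] at this
  exact this

/-- Otherwise the densities vanish almost everywhere on $F_s$, hence $V_1=0$ almost everywhere and
the instrument is efficient. -/
theorem exists_op_ne_zero [SigmaFinite μ] [TopologicalSpace.SeparableSpace H]
    (hV : KrausRepresentation M μ D V) (heff : ¬ M.IsEfficient) :
    ∃ F, MeasurableSet F ∧ F ⊆ {x | V 1 x ≠ 0} ∧ M.op F ≠ 0 := by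
  by_contra! hall
  obtain ⟨t, htF, htm, hte⟩ := (hV.nullMeasurableSet_support 1).exists_measurable_subset_ae_eq
  have h0 := hall t htm htF
  refine heff (hV.isEfficient_of_ae_eq_zero ?_)
  obtain ⟨f, hf⟩ := hV.exists_seq_span
  have hzero : ∀ φ : D, ∀ᵐ x ∂μ.restrict t, V 1 x φ = 0 := by
    intro φ
    have h := hV.trace_op_ketBra φ htm
    rw [h0, LinearMap.zero_apply, trace_eq_traceMul_id, map_zero, eq_comm,
      Complex.ofReal_eq_zero, ENNReal.toReal_eq_zero_iff, or_iff_left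
        ((setLIntegral_le_lintegral _ _).trans_lt (hV.lintegral_lt_top φ)).ne,
      lintegral_eq_zero_iff' (hV.aemeasurable_density φ).restrict] at h
    filter_upwards [h] with x hx
    simpa using ENNReal.tsum_eq_zero.mp hx 1
  have hall' := ae_all_iff.mpr fun n => hzero (f n)
  rw [ae_restrict_iff' htm] at hall'
  filter_upwards [hall', hte] with x hx hxt
  by_contra hne
  exact hne (LinearMap.ext_on_range hf fun n => hx (hxt.mpr hne) n)

end KrausRepresentation

/-- This excludes $\mathcal H=0$, where no unit vectors $\psi_x$ exist. -/
theorem Instrument.isEfficient_of_subsingleton [Subsingleton H] (M : Instrument X H) :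
    M.IsEfficient := by
  refine ⟨Lp ℂ 2 (0 : Measure X), inferInstance, inferInstance, inferInstance,
    multiplicationMeasure 0, ⟨0, fun y => ?_⟩, multiplicationMeasure_hasMultiplicityOne 0,
    fun F hF A T => ?_⟩
  · rw [Subsingleton.elim y 0]; simp
  · congr 1
    exact Subsingleton.elim _ _

end Efficiency
end QuantumInstrument

theorem mainTheorem9 {H : Type*} [NormedAddCommGroup H] [InnerProductSpace ℂ H]
    [CompleteSpace H] [TopologicalSpace.SeparableSpace H] {X : Type*} [MeasurableSpace X]
    (M : QuantumInstrument.Instrument X H) (hirr : M.IsIrreducible) (heff : ¬ M.IsEfficient)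
    (μ : Measure X) [SigmaFinite μ] (D : Submodule ℂ H) (V : ℕ → X → D →ₗ[ℂ] H)
    (hV : QuantumInstrument.KrausRepresentation M μ D V)
    (Fs : Set X) (hFs : Fs = {x | V 1 x ≠ 0}) :
    (∃ F, MeasurableSet F ∧ F ⊆ Fs ∧ M.op F ≠ 0) ∧
    ∃ (ψ : X → H) (ω : ℕ → X → D →ₗ[ℂ] ℂ),
      StronglyMeasurable ψ ∧ (∀ x, ‖ψ x‖ = 1) ∧
      (∀ᵐ x ∂μ, x ∈ Fs → ∀ k,
        (V k x ≠ 0 → LinearMap.range (V k x) = Submodule.span ℂ {ψ x}) ∧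
        ∀ φ : D, V k x φ = ω k x φ • ψ x) ∧
      (∀ (φ : D) (A : H →L[ℂ] H) (F : Set X), MeasurableSet F → F ⊆ Fs →
        QuantumInstrument.trace
            (A ∘L (M.op F (QuantumInstrument.ketBra (φ : H) φ) : H →L[ℂ] H)) =
          ∫ x in F, ⟪ψ x, A (ψ x)⟫_ℂ * ((∑' k, ‖ω k x φ‖ ^ 2 : ℝ) : ℂ) ∂μ) ∧
      ∀ (ρ : QuantumInstrument.traceClass H) (hρ : QuantumInstrument.IsState ρ),
        (∀ (F : Set X), MeasurableSet F → F ⊆ Fs → ∀ A : H →L[ℂ] H,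
          QuantumInstrument.trace (A ∘L (M.op F ρ : H →L[ℂ] H)) =
            ∫ x in F, ⟪ψ x, A (ψ x)⟫_ℂ ∂(M.outcomeMeasure ρ hρ)) ∧
        ∀ r : X → QuantumInstrument.traceClass H, M.IsPosteriorFamily ρ hρ r →
          ∀ᵐ x ∂(M.outcomeMeasure ρ hρ), x ∈ Fs → r x = QuantumInstrument.ketBra (ψ x) (ψ x) := by
  subst hFs
  refine ⟨hV.exists_op_ne_zero heff, ?_⟩
  have hnt : Nontrivial H := by
    by_contra h
    rw [not_nontrivial_iff_subsingleton] at h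
    exact heff M.isEfficient_of_subsingleton
  obtain ⟨u₀, hu₀⟩ := exists_norm_eq H zero_le_one
  obtain ⟨ψ, hψm, hψ, hVψ⟩ := hV.exists_direction hirr hu₀
  have hVF : ∀ F : Set X, MeasurableSet F → F ⊆ {x | V 1 x ≠ 0} →
      ∀ᵐ x ∂μ.restrict F, ∀ k φ, V k x φ = ⟪ψ x, V k x φ⟫_ℂ • ψ x := by
    intro F hF hFs
    rw [ae_restrict_iff' hF]
    filter_upwards [hVψ] with x hx hxF using hx (hFs hxF)
  -- The functional is the coefficient $\omega_k(x)[\varphi]=\langle\psi_x,V_k(x)\varphi\rangle$,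
  -- possibly unbounded like $V_k(x)$.
  refine ⟨ψ, fun k x => (innerSL ℂ (ψ x) : H →ₗ[ℂ] ℂ) ∘ₗ V k x, hψm, hψ, ?_, ?_, ?_⟩
  · filter_upwards [hVψ] with x hx hxF k
    refine ⟨fun hk => le_antisymm ?_ ?_, fun φ => hx hxF k φ⟩
    · rintro _ ⟨φ, rfl⟩
      exact Submodule.mem_span_singleton.mpr ⟨_, (hx hxF k φ).symm⟩
    · rw [Submodule.span_singleton_le_iff_mem]
      obtain ⟨φ, hφ⟩ : ∃ φ, V k x φ ≠ 0 := by
        by_contra! h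
        exact hk (LinearMap.ext h)
      have hne : ⟪ψ x, V k x φ⟫_ℂ ≠ 0 := fun h => hφ (by rw [hx hxF k φ, h, zero_smul])
      refine ⟨(⟪ψ x, V k x φ⟫_ℂ)⁻¹ • φ, ?_⟩
      rw [map_smul, inv_smul_eq_iff₀ hne]
      exact hx hxF k φ
  · intro φ A F hF hFs
    rw [hV.trace_eq φ F hF A]
    refine integral_congr_ae ?_
    filter_upwards [hVF F hF hFs] with x hx
    exact QuantumInstrument.tsum_inner_map_of_forall_eq_smul (fun k => hx k φ) A
  · intro ρ hρ
    exact ⟨fun F hF hFs A => hV.traceMul_op_eq_integral hψm hψ hF (hVF F hF hFs) hρ A,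
      fun r hr => hV.ae_eq_ketBra hψm hψ hVψ hρ hr⟩
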